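/- Let $n\ge 1$. Let $MA(n,\mathbb C)$ be the set of affine maps $f(x)=Ax+a$ of $\mathbb C^n$, where $A\in M_n(\mathbb C)$ and $a\in\mathbb C^n$ (write $f=(A,a)$), and let $GA(n,\mathbb C)$ be the group of invertible ones. For $f=(A,a)$ put $$\Phi(f)=\begin{bmatrix}1&0\\ a&A\end{bmatrix},\qquad \Psi(f)=\begin{bmatrix}0&0\\ a&A\end{bmatrix}\in M_{n+1}(\mathbb C).$$ For a tuple $\eta=(n_1,\dots,n_r)$ of positive integers with $n_1+\dots+n_r=n+1$, let $\mathcal K_{\eta,r}(\mathbb C)=\mathbb T_{n_1}(\mathbb C)\oplus\dots\oplus\mathbb T_{n_r}(\mathbb C)$ be the algebra of block-diagonal matrices, where $\mathbb T_m(\mathbb C)$ is the set of lower triangular $m\times m$ matrices with all diagonal entries equal. Let $u_0=(e_{1,1},\dots,e_{r,1})\in\mathbb C^{n+1}$ with $e_{k,1}=(1,0,\dots,0)\in\mathbb C^{n_k}$, and let $p_2:\mathbb C\times\mathbb C^n\to\mathbb C^n$ be the second projection. Let $\mathcal G$ be an abelian sub-semigroup (under composition) of $MA(n,\mathbb C)$.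 Then there exist $\eta$ as above and $P\in\Phi(GA(n,\mathbb C))$ such that $P^{-1}\Phi(\mathcal G)P\subset\mathcal K_{\eta,r}(\mathbb C)$. Moreover, for every such choice of $\eta$ and $P$, put $w_0=p_2(Pu_0)$ and $$\mathfrak q=\{f\in MA(n,\mathbb C):\ e^{\Psi(f)}\in\Phi(\mathcal G)\ \text{ and }\ \Psi(f)\in P\,\mathcal K_{\eta,r}(\mathbb C)\,P^{-1}\},\qquad \mathfrak q_{w_0}=\{f(w_0):\ f\in\mathfrak q\}.$$ Then the following are equivalent: (i) $\mathcal G$ is hypercyclic, i.e. there is $v\in\mathbb C^n$ such that $\mathcal G(v)=\{f(v): f\in\mathcal G\}$ is dense in $\mathbb C^n$; (ii) the orbit $\mathcal G(w_0)$ is dense in $\mathbb C^n$; (iii) $\mathfrak q_{w_0}$ is an additive sub-semigroup of $\mathbb C^n$ and is dense in $\mathbb C^n$. -/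

import Mathlib

namespace AffineSemigroup

/-- The affine maps `f(x) = A x + a` of `ℂⁿ`. They form a monoid under composition
(`f * g = f ∘ g`) and a complex vector space under pointwise operations. -/
abbrev MA (n : ℕ) : Type := (Fin n → ℂ) →ᵃ[ℂ] (Fin n → ℂ)

/-- The invertible affine maps of `ℂⁿ`. -/
abbrev GA (n : ℕ) : Type := (Fin n → ℂ) ≃ᵃ[ℂ] (Fin n → ℂ)

/-- The matrix `[c 0; a A]` attached to the affine map `x ↦ A x + a` and the corner entry `c`. -/
def blockMatrix {n : ℕ} (c : ℂ) (f : MA n) : Matrix (Fin (n + 1)) (Fin (n + 1)) ℂ :=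
  Matrix.of (Fin.cons (Fin.cons c 0)
    (fun i => Fin.cons (f 0 i) (LinearMap.toMatrix' f.linear i)))

/-- `Φ(A, a) = [1 0; a A]`. -/
def Phi {n : ℕ} (f : MA n) : Matrix (Fin (n + 1)) (Fin (n + 1)) ℂ := blockMatrix 1 f

/-- `Ψ(A, a) = [0 0; a A]`. -/
def Psi {n : ℕ} (f : MA n) : Matrix (Fin (n + 1)) (Fin (n + 1)) ℂ := blockMatrix 0 f

/-- For `η = (n₁, …, n_r)` with all `n_k ≥ 1` and `n₁ + ⋯ + n_r = m`, the set
`𝕋_{n₁}(ℂ) ⊕ ⋯ ⊕ 𝕋_{n_r}(ℂ)` of block diagonal matrices whose `k`-th diagonal block is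
`n_k × n_k`, lower triangular, with a constant diagonal. -/
def blockAlgebra {m : ℕ} (η : Composition m) : Set (Matrix (Fin m) (Fin m) ℂ) :=
  {M | (∀ i j, η.index i ≠ η.index j → M i j = 0) ∧
       (∀ i j, i < j → M i j = 0) ∧
       (∀ i j, η.index i = η.index j → M i i = M j j)}

/-- The vector `u₀ = (e_{1,1}, …, e_{r,1})`: its coordinates are `1` at the first position of
every block of `η`, and `0` elsewhere. -/
def u₀ {m : ℕ} (η : Composition m) : Fin m → ℂ :=
  fun i => if (η.invEmbedding i : ℕ) = 0 then 1 else 0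

/-- The pair `(η, φ)` brings the semigroup `𝒢` to normal form: with `P = Φ(φ)`, one has
`P⁻¹ Φ(𝒢) P ⊆ 𝕋_{n₁}(ℂ) ⊕ ⋯ ⊕ 𝕋_{n_r}(ℂ)`. -/
def IsNormalForm {n : ℕ} (𝒢 : Subsemigroup (MA n)) (η : Composition (n + 1)) (φ : GA n) : Prop :=
  ∀ f ∈ 𝒢, (Phi (φ : MA n))⁻¹ * Phi f * Phi (φ : MA n) ∈ blockAlgebra η

/-- `w₀ = p₂(P u₀)`, where `P = Φ(φ)` and `p₂` forgets the first coordinate. -/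
def w₀ {n : ℕ} (η : Composition (n + 1)) (φ : GA n) : Fin n → ℂ :=
  Fin.tail (Matrix.mulVec (Phi (φ : MA n)) (u₀ η))

/-- `g = exp⁻¹(Φ(𝒢)) ∩ P (𝕋_{n₁}(ℂ) ⊕ ⋯ ⊕ 𝕋_{n_r}(ℂ)) P⁻¹`, where `P = Φ(φ)`. -/
def logs {n : ℕ} (𝒢 : Subsemigroup (MA n)) (η : Composition (n + 1)) (φ : GA n) :
    Set (Matrix (Fin (n + 1)) (Fin (n + 1)) ℂ) :=
  {B | NormedSpace.exp B ∈ Phi '' (𝒢 : Set (MA n))} ∩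
    (fun M => Phi (φ : MA n) * M * (Phi (φ : MA n))⁻¹) '' blockAlgebra η

/-- `𝔮 = Ψ⁻¹(g¹)`, where `g¹ = g ∩ Ψ(MA(n, ℂ))`. -/
def affineLogs {n : ℕ} (𝒢 : Subsemigroup (MA n)) (η : Composition (n + 1)) (φ : GA n) :
    Set (MA n) :=
  Psi ⁻¹' (logs 𝒢 η φ ∩ Set.range (Psi (n := n)))

/-- For a set `S` of affine maps, `S_v = {f(v) : f ∈ S}`; for a semigroup this is the orbit
of `v`. -/
def orbit {n : ℕ} (S : Set (MA n)) (v : Fin n → ℂ) : Set (Fin n → ℂ) := {y | ∃ f ∈ S, f v = y}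

/-- Some vector has a dense orbit. -/
def IsHypercyclic {n : ℕ} (𝒢 : Subsemigroup (MA n)) : Prop :=
  ∃ v : Fin n → ℂ, Dense (orbit (𝒢 : Set (MA n)) v)

end AffineSemigroup

/-! Density of an orbit is compared with density of its logarithms inside a commutative matrix
algebra `A`: the one generated by `Φ(𝒢)` when passing to logarithms, by `Ψ(𝔮)` when coming back.
Density of values at `w` makes `(1, w)` a cyclic vector of `A`; since `A` is commutative, `a ↦ a (1,
w)` is then a linear isomorphism `A ≃ ℂⁿ⁺¹` (`evalEquiv`). Matrices of `A` have first row `(χ, 0, …,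
0)`, so the corner entry is a character `χ`. Values of `𝒢` at `w` become points of `{χ = 1}`, values
of `𝔮` points of `{χ = 0}`, and it remains to move density along `exp`. Backwards this holds because
`exp` is locally onto (`mem_closure_exp_preimage`); forwards because the units of `{χ = 1}` are
exponentials and are dense there (`mem_closure_exp_image`).

`𝔮` is closed under addition because logarithms in the block algebra commute once their exponentials
do: there `ad B` is nilpotent, so `exp (ad B) C = C` forces `[B, C] = 0`.

If `x` has a dense orbit, some `B ∈ A` sends `(1, x)` to `(1, w₀) = P u₀`. A block triangular matrix
with `u₀` in its range is invertible, so `B` is an affine bijection commuting with `𝒢` and carries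
the orbit of `x` onto that of `w₀`.

The normal form comes from the joint generalized eigenspaces of `Φ(𝒢)`, triangularized one by one;
the first coordinate functional, fixed by all of `Φ(𝒢)`, is kept as first dual basis vector, so that
`P ∈ Φ(GA)`. -/

namespace AffineSemigroup

open Filter Topology NormedSpace Module
open scoped Matrix.Norms.Operator

/-! ### The exponential of a commutative algebra and density -/

section BanachAlgebra

variable {A : Type*} [NormedRing A] [NormedAlgebra ℂ A] [CompleteSpace A]

lemma continuous_exp_of_complex : Continuous (exp : A → A) := by
  let := NormedAlgebra.restrictScalars ℚ ℂ A
  exact exp_continuous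

lemma exp_add_of_commute_complex {a b : A} (h : Commute a b) : exp (a + b) = exp a * exp b := by
  let := NormedAlgebra.restrictScalars ℚ ℂ A
  exact exp_add_of_commute h

lemma exp_neg_mul_exp (a : A) : exp (-a) * exp a = 1 := by
  rw [← exp_add_of_commute_complex (Commute.refl a).neg_left, neg_add_cancel, exp_zero]

lemma exp_mul_exp_neg (a : A) : exp a * exp (-a) = 1 := by
  rw [← exp_add_of_commute_complex (Commute.refl a).neg_right, add_neg_cancel, exp_zero]

lemma map_exp_complex {B : Type*} [NormedRing B] [NormedAlgebra ℂ B] (f : A →ₐ[ℂ] B)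
    (hf : Continuous f) (a : A) : f (exp a) = exp (f a) := by
  let := NormedAlgebra.restrictScalars ℚ ℂ A
  let := NormedAlgebra.restrictScalars ℚ ℂ B
  exact map_exp f hf a

/-- The exponential of a Banach algebra maps neighbourhoods of `0` onto neighbourhoods of `1`. -/
lemma map_exp_nhds_zero : map (exp : A → A) (𝓝 0) = 𝓝 1 := by
  have h : HasStrictFDerivAt (exp : A → A)
      ((ContinuousLinearEquiv.refl ℂ A : A ≃L[ℂ] A) : A →L[ℂ] A) 0 :=
    hasStrictFDerivAt_exp_zero (𝕂 := ℂ)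
  simpa using h.map_nhds_eq_of_equiv

lemma eventually_mem_range_exp : ∀ᶠ x in 𝓝 (1 : A), x ∈ Set.range (exp : A → A) := by
  rw [← map_exp_nhds_zero]
  exact eventually_map.2 (Eventually.of_forall fun x => ⟨x, rfl⟩)

/-- In a commutative Banach algebra the range of `exp` is open. -/
lemma isOpen_range_exp (hc : ∀ a b : A, a * b = b * a) : IsOpen (Set.range (exp : A → A)) := by
  rw [isOpen_iff_eventually]
  rintro _ ⟨a, rfl⟩
  have ht : Tendsto (fun x => exp (-a) * x) (𝓝 (exp a)) (𝓝 1) := by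
    have := (continuous_const_mul (exp (-a))).tendsto (exp a)
    rwa [exp_neg_mul_exp] at this
  filter_upwards [ht.eventually eventually_mem_range_exp] with x hx
  obtain ⟨b, hb⟩ := hx
  refine ⟨a + b, ?_⟩
  rw [exp_add_of_commute_complex (hc a b), hb, ← mul_assoc, exp_mul_exp_neg, one_mul]

/-- In a commutative Banach algebra the units outside the range of `exp` form an open set. -/
lemma isOpen_units_diff_range_exp (hc : ∀ a b : A, a * b = b * a) :
    IsOpen {x : A | IsUnit x ∧ x ∉ Set.range (exp : A → A)} := by
  rw [isOpen_iff_eventually]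
  rintro x ⟨⟨u, rfl⟩, hx⟩
  have ht : Tendsto (fun y => (↑u⁻¹ : A) * y) (𝓝 (u : A)) (𝓝 1) := by
    have := (continuous_const_mul (↑u⁻¹ : A)).tendsto (u : A)
    rwa [Units.inv_mul] at this
  filter_upwards [ht.eventually eventually_mem_range_exp, Units.isOpen.mem_nhds u.isUnit]
    with y hy hyu
  refine ⟨hyu, ?_⟩
  rintro ⟨c, rfl⟩
  obtain ⟨b, hb⟩ := hy
  -- If `u⁻¹ y = exp b` and `y = exp c`, then `u = exp (c - b)`, against `hx`.
  refine hx ⟨c - b, ?_⟩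
  rw [sub_eq_add_neg, exp_add_of_commute_complex (hc _ _)]
  have h1 : exp c = u * exp b := by rw [hb, Units.mul_inv_cancel_left]
  rw [h1, mul_assoc, exp_mul_exp_neg, mul_one]

omit [CompleteSpace A] in
lemma finite_spectrum_of_finiteDimensional [FiniteDimensional ℂ A] (a : A) :
    (spectrum ℂ a).Finite := by
  rcases subsingleton_or_nontrivial A with h | h
  · rw [spectrum.of_subsingleton]; exact Set.finite_empty
  have hi : IsIntegral ℂ a := IsIntegral.of_finite ℂ a
  refine ((minpoly ℂ a).roots.toFinset.finite_toSet).subset fun z hz => ?_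
  have h0 := spectrum.subset_polynomial_aeval a (minpoly ℂ a) ⟨z, hz, rfl⟩
  rw [minpoly.aeval, spectrum.zero_eq] at h0
  simpa [minpoly.ne_zero hi] using h0

omit [CompleteSpace A] in
/-- On a complex affine line through `1` in a finite dimensional algebra, all but finitely many
points are units. -/
lemma finite_nonunit_line [FiniteDimensional ℂ A] (a : A) :
    {t : ℂ | ¬ IsUnit ((1 - t) • (1 : A) + t • a)}.Finite := by
  refine ((finite_spectrum_of_finiteDimensional (1 - a)).image (fun z => z⁻¹)).subset ?_
  intro t ht
  have ht0 : t ≠ 0 := by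
    rintro rfl
    simp at ht
  refine ⟨t⁻¹, ?_, inv_inv t⟩
  intro hu
  apply ht
  -- So a nonunit at `t` means that `t⁻¹` is in the spectrum of `1 - a`.
  have h2 : (1 - t) • (1 : A) + t • a = algebraMap ℂ A t * (algebraMap ℂ A t⁻¹ - (1 - a)) := by
    rw [mul_sub, ← map_mul, mul_inv_cancel₀ ht0, map_one, ← Algebra.smul_def, sub_smul, one_smul,
      smul_sub]
    abel
  rw [h2]
  exact ((IsUnit.mk0 t ht0).map (algebraMap ℂ A)).mul hu

/-- In a finite dimensional commutative algebra, the units on a complex line through `1` are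
exponentials. -/
lemma line_mem_range_exp [FiniteDimensional ℂ A] (hc : ∀ a b : A, a * b = b * a) (a : A) (t : ℂ)
    (ht : IsUnit ((1 - t) • (1 : A) + t • a)) :
    (1 - t) • (1 : A) + t • a ∈ Set.range (exp : A → A) := by
  set p : ℂ → A := fun t => (1 - t) • (1 : A) + t • a with hp
  have hpc : Continuous p := by fun_prop
  -- The plane minus finitely many points is connected, and exponentials and non-exponential units
  -- split it into two disjoint open sets; the point `t = 0` gives `1 = exp 0`.
  have hconn : IsPreconnected {t : ℂ | ¬ IsUnit (p t)}ᶜ :=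
    ((finite_nonunit_line a).countable.isPathConnected_compl_of_one_lt_rank
      (by rw [Complex.rank_real_complex]; exact Cardinal.one_lt_two)).isConnected.isPreconnected
  have hsub := hconn.subset_left_of_subset_union
    ((isOpen_range_exp hc).preimage hpc) ((isOpen_units_diff_range_exp hc).preimage hpc)
    (Set.disjoint_left.2 fun s hs hs' => hs'.2 hs)
    (fun s hs => by
      have hs' : IsUnit (p s) := not_not.1 hs
      by_cases h : p s ∈ Set.range (exp : A → A)
      · exact Or.inl h
      · exact Or.inr ⟨hs', h⟩)
    ⟨0, by simp [hp], ⟨0, by simp [hp]⟩⟩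
  exact hsub (not_not.2 ht)

variable [FiniteDimensional ℂ A] (χ : A →ₐ[ℂ] ℂ)

omit [CompleteSpace A] in
lemma continuous_character : Continuous χ :=
  χ.toLinearMap.continuous_of_finiteDimensional

omit [FiniteDimensional ℂ A] in
-- A logarithm of a point of `{χ = 1}` may have `χ a ∈ 2πiℤ` nonzero; removing this scalar brings it
-- into `{χ = 0}` at no cost.
lemma exp_sub_character (a : A) (h : exp (χ a) = 1) :
    exp (a - algebraMap ℂ A (χ a)) = exp a ∧ χ (a - algebraMap ℂ A (χ a)) = 0 := by
  constructor
  · rw [sub_eq_add_neg, ← map_neg, exp_add_of_commute_complex (Algebra.commutes' _ _).symm,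
      ← algebraMap_exp_comm]
    have : exp (-(χ a)) = 1 := by
      have := exp_neg_mul_exp (χ a)
      rwa [h, mul_one] at this
    rw [this, map_one, mul_one]
  · simp

/-- If `S` is dense in `{χ = 1}`, then `exp ⁻¹ S` is dense in `{χ = 0}`. -/
lemma mem_closure_exp_preimage (hc : ∀ a b : A, a * b = b * a) (S : Set A)
    (hS1 : ∀ s ∈ S, χ s = 1) (hS : ∀ a, χ a = 1 → a ∈ closure S) (a : A) (ha : χ a = 0) :
    a ∈ closure {b | χ b = 0 ∧ exp b ∈ S} := by
  have hea : χ (exp a) = 1 := by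
    rw [map_exp_complex χ (continuous_character χ), ha, exp_zero]
  rw [mem_closure_iff_nhds]
  intro U hU
  have hcont : Continuous fun b : A => a + (b - algebraMap ℂ A (χ b)) := by
    have := continuous_character χ
    have h2 := continuous_algebraMap ℂ A
    fun_prop
  -- Points of `S` near `exp a` are `exp a * exp b` with `b` small. The neighbourhood is taken for
  -- the corrected `b - χ b`, since only `exp (χ b) = 1` will be known.
  have hV : (fun b : A => a + (b - algebraMap ℂ A (χ b))) ⁻¹' U ∈ 𝓝 (0 : A) := by
    apply hcont.continuousAt.preimage_mem_nhds
    simpa using hU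
  have hW : exp '' ((fun b : A => a + (b - algebraMap ℂ A (χ b))) ⁻¹' U) ∈ 𝓝 (1 : A) := by
    rw [← map_exp_nhds_zero]
    exact image_mem_map hV
  have ht : Tendsto (fun x => exp (-a) * x) (𝓝 (exp a)) (𝓝 1) := by
    have := (continuous_const_mul (exp (-a))).tendsto (exp a)
    rwa [exp_neg_mul_exp] at this
  obtain ⟨s, ⟨b, hb, hbs⟩, hsS⟩ := mem_closure_iff_nhds.1 (hS _ hea) _ (ht hW)
  have hχb : exp (χ b) = 1 := by
    rw [← map_exp_complex χ (continuous_character χ), hbs, map_mul, hS1 s hsS, mul_one,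
      map_exp_complex χ (continuous_character χ), map_neg, ha, neg_zero, exp_zero]
  obtain ⟨h1, h2⟩ := exp_sub_character χ b hχb
  refine ⟨a + (b - algebraMap ℂ A (χ b)), hb, by rw [map_add, ha, h2, add_zero], ?_⟩
  rw [exp_add_of_commute_complex (hc _ _), h1, hbs, ← mul_assoc, exp_mul_exp_neg, one_mul]
  exact hsS

/-- If `T` is dense in `{χ = 0}`, then `exp T` is dense in `{χ = 1}`. -/
lemma mem_closure_exp_image (hc : ∀ a b : A, a * b = b * a) (T : Set A)
    (hT : ∀ a, χ a = 0 → a ∈ closure T) (a : A) (ha : χ a = 1) :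
    a ∈ closure (exp '' T) := by
  have key : ∀ t : ℂ, IsUnit ((1 - t) • (1 : A) + t • a) →
      (1 - t) • (1 : A) + t • a ∈ closure (exp '' T) := by
    intro t ht
    obtain ⟨b, hb⟩ := line_mem_range_exp hc a t ht
    have hχb : exp (χ b) = 1 := by
      rw [← map_exp_complex χ (continuous_character χ), hb]
      simp [ha]
    obtain ⟨h1, h2⟩ := exp_sub_character χ b hχb
    rw [← hb, ← h1]
    exact image_closure_subset_closure_image continuous_exp_of_complex
      ⟨_, hT _ h2, rfl⟩
  -- The point `a`, at `t = 1`, need not be a unit; it is a limit of units on the line from `1`.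
  have hd : Dense {t : ℂ | ¬ IsUnit ((1 - t) • (1 : A) + t • a)}ᶜ :=
    (finite_nonunit_line a).countable.dense_compl ℝ
  have hcont : Continuous fun t : ℂ => (1 - t) • (1 : A) + t • a := by fun_prop
  have h1 : (fun t : ℂ => (1 - t) • (1 : A) + t • a) 1 ∈
      closure ((fun t : ℂ => (1 - t) • (1 : A) + t • a) ''
        {t : ℂ | ¬ IsUnit ((1 - t) • (1 : A) + t • a)}ᶜ) :=
    image_closure_subset_closure_image hcont ⟨1, hd 1, rfl⟩
  have h2 := closure_mono (t := closure (exp '' T)) (by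
    rintro _ ⟨t, ht, rfl⟩
    exact key t (not_not.1 ht)) h1
  simpa using h2

end BanachAlgebra

/-! ### Commuting with an exponential -/

section Commutation

/-- If `exp X` fixes a vector on which some power of `X` vanishes, then `X` kills that vector. -/
lemma apply_eq_zero_of_exp_apply_eq {E : Type*} [NormedAddCommGroup E] [NormedSpace ℂ E]
    [CompleteSpace E] (X : E →L[ℂ] E) (c : E) (h : exp X c = c) (m : ℕ) (hm : (X ^ m) c = 0) :
    X c = 0 := by
  induction m with
  | zero => simp only [pow_zero, one_apply_eq_self] at hm; rw [hm, map_zero]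
  | succ k ih =>
    rcases Nat.eq_zero_or_pos k with rfl | hk
    · simpa using hm
    obtain ⟨l, rfl⟩ : ∃ l, k = l + 1 := ⟨k - 1, by omega⟩
    apply ih
    -- Applying `X ^ l` to `exp X c = c` leaves `X ^ l c + X ^ (l + 1) c = X ^ l c`, as higher
    -- powers vanish; hence `X ^ (l + 1) c = 0`, one power less.
    have hs := (exp_series_hasSum_exp' (𝕂 := ℂ) X).mapL
      ((X ^ l).comp (ContinuousLinearMap.apply ℂ E c))
    have hv : ∀ j, ((X ^ l).comp (ContinuousLinearMap.apply ℂ E c)) (((j.factorial : ℂ))⁻¹ • X ^ j) =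
        ((j.factorial : ℂ))⁻¹ • (X ^ (l + j)) c := by
      intro j
      simp [pow_add]
    have hz : ∀ j ∉ Finset.range 2, ((X ^ l).comp (ContinuousLinearMap.apply ℂ E c))
        (((j.factorial : ℂ))⁻¹ • X ^ j) = 0 := by
      intro j hj
      obtain ⟨i, rfl⟩ : ∃ i, j = i + 2 := ⟨j - 2, by simp at hj; omega⟩
      rw [hv, show l + (i + 2) = i + (l + 1 + 1) by omega, pow_add,
        mul_apply_eq_comp, hm, map_zero, smul_zero]
    have he := hs.unique (hasSum_sum_of_ne_finset_zero hz)
    simp only [hv, Finset.sum_range_succ, Finset.sum_range_zero] at he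
    simpa [h] using he

variable {A : Type*} [NormedRing A] [NormedAlgebra ℂ A] [CompleteSpace A]

lemma exp_mul_left_apply (a c : A) : exp (ContinuousLinearMap.mul ℂ A a) c = exp a * c := by
  have h1 := (exp_series_hasSum_exp' (𝕂 := ℂ) (ContinuousLinearMap.mul ℂ A a)).mapL
    (ContinuousLinearMap.apply ℂ A c)
  have h2 := (exp_series_hasSum_exp' (𝕂 := ℂ) a).mul_right c
  refine h1.unique ?_
  convert! h2 using 2 with k
  have : ∀ k : ℕ, ((ContinuousLinearMap.mul ℂ A a) ^ k) c = a ^ k * c := by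
    intro k
    induction k with
    | zero => simp
    | succ k ih => simp [pow_succ', ih, mul_assoc]
  simp [this]

lemma exp_mul_right_apply (a c : A) :
    exp ((ContinuousLinearMap.mul ℂ A).flip a) c = c * exp a := by
  have h1 := (exp_series_hasSum_exp' (𝕂 := ℂ) ((ContinuousLinearMap.mul ℂ A).flip a)).mapL
    (ContinuousLinearMap.apply ℂ A c)
  have h2 := (exp_series_hasSum_exp' (𝕂 := ℂ) a).mul_left c
  refine h1.unique ?_
  convert! h2 using 2 with k
  have : ∀ k : ℕ, (((ContinuousLinearMap.mul ℂ A).flip a) ^ k) c = c * a ^ k := by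
    intro k
    induction k with
    | zero => simp
    | succ k ih => rw [pow_succ', mul_apply_eq_comp, ih]; simp [pow_succ, mul_assoc]
  simp [this]

/-- If `c` commutes with `exp a` and is killed by an iterated commutator with `a`, then `c`
commutes with `a`. -/
lemma commute_of_commute_exp (a c : A) (h : Commute (exp a) c) (m : ℕ)
    (hm : (fun x => a * x - x * a)^[m] c = 0) : Commute a c := by
  set l := ContinuousLinearMap.mul ℂ A a with hl
  set r := (ContinuousLinearMap.mul ℂ A).flip a with hr
  have hlr : Commute l (-r) := by
    apply Commute.neg_right
    ext x
    simp [hl, hr, mul_assoc]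
  have hneg : -r = (ContinuousLinearMap.mul ℂ A).flip (-a) := by simp [hr]
  -- `l - r` is the commutator with `a`, and its exponential is conjugation by `exp a`.
  have hfix : exp (l - r) c = c := by
    rw [sub_eq_add_neg, exp_add_of_commute_complex hlr, mul_apply_eq_comp, hneg,
      exp_mul_right_apply, exp_mul_left_apply, ← mul_assoc, h.eq, mul_assoc, exp_mul_exp_neg,
      mul_one]
  have hpow : ∀ m, ((l - r) ^ m) c = (fun x => a * x - x * a)^[m] c := by
    intro m
    induction m with
    | zero => simp
    | succ k ih =>
      rw [pow_succ', mul_apply_eq_comp, ih, Function.iterate_succ_apply']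
      simp [hl, hr]
  have := apply_eq_zero_of_exp_apply_eq (l - r) c hfix m (by rw [hpow, hm])
  exact sub_eq_zero.1 (by simpa [hl, hr] using this)

end Commutation

/-! ### The block triangular algebra -/

section BlockAlgebra

variable {m : ℕ} (η : Composition m)

/-- `blockAlgebra η` as a subalgebra. -/
def blockSubalgebra : Subalgebra ℂ (Matrix (Fin m) (Fin m) ℂ) where
  carrier := blockAlgebra η
  mul_mem' := by
    rintro M N ⟨hM1, hM2, hM3⟩ ⟨hN1, hN2, hN3⟩
    have hdiag : ∀ i, (M * N) i i = M i i * N i i := by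
      intro i
      rw [Matrix.mul_apply]
      apply Finset.sum_eq_single_of_mem i (Finset.mem_univ _)
      intro l _ hl
      rcases lt_or_gt_of_ne hl with h | h
      · rw [hN2 l i h, mul_zero]
      · rw [hM2 i l h, zero_mul]
    refine ⟨fun i j hij => ?_, fun i j hij => ?_, fun i j hij => ?_⟩
    · rw [Matrix.mul_apply]
      apply Finset.sum_eq_zero
      intro l _
      by_cases h : η.index i = η.index l
      · rw [hN1 l j (fun h' => hij (h.trans h')), mul_zero]
      · rw [hM1 i l h, zero_mul]
    · rw [Matrix.mul_apply]
      apply Finset.sum_eq_zero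
      intro l _
      rcases lt_or_ge i l with h | h
      · rw [hM2 i l h, zero_mul]
      · rw [hN2 l j (h.trans_lt hij), mul_zero]
    · rw [hdiag, hdiag, hM3 i j hij, hN3 i j hij]
  add_mem' := by
    rintro M N ⟨hM1, hM2, hM3⟩ ⟨hN1, hN2, hN3⟩
    refine ⟨fun i j hij => ?_, fun i j hij => ?_, fun i j hij => ?_⟩
    · simp [hM1 i j hij, hN1 i j hij]
    · simp [hM2 i j hij, hN2 i j hij]
    · simp [hM3 i j hij, hN3 i j hij]
  algebraMap_mem' := by
    intro z
    refine ⟨fun i j hij => ?_, fun i j hij => ?_, fun i j hij => ?_⟩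
    · exact Matrix.algebraMap_matrix_apply.trans (if_neg (fun h => hij (by rw [h])))
    · exact Matrix.algebraMap_matrix_apply.trans (if_neg hij.ne)
    · simp [Matrix.algebraMap_matrix_apply]

/-- Iterated commutators inside `blockAlgebra η` move down the subdiagonals. -/
lemma iterate_commutator_mem {B C : Matrix (Fin m) (Fin m) ℂ} (hB : B ∈ blockSubalgebra η)
    (hC : C ∈ blockSubalgebra η) (k : ℕ) :
    (fun X => B * X - X * B)^[k] C ∈ blockSubalgebra η ∧
      ∀ i j : Fin m, (i : ℕ) < j + k → ((fun X => B * X - X * B)^[k] C) i j = 0 := by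
  induction k with
  | zero => exact ⟨hC, fun i j hij => hC.2.1 i j (by simpa using hij)⟩
  | succ k ih =>
    rw [Function.iterate_succ_apply']
    set X := (fun X => B * X - X * B)^[k] C
    obtain ⟨hX, hX0⟩ := ih
    refine ⟨sub_mem (mul_mem hB hX) (mul_mem hX hB), fun i j hij => ?_⟩
    -- On the first subdiagonal not yet known to vanish only diagonal entries of `B` contribute,
    -- giving `(B i i - B j j) * X i j`; one factor is zero, according to whether `i` and `j` share
    -- a block.
    have h1 : (B * X) i j = B i i * X i j := by
      rw [Matrix.mul_apply]
      apply Finset.sum_eq_single_of_mem i (Finset.mem_univ _)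
      intro l _ hl
      rcases lt_or_gt_of_ne hl with h | h
      · rw [hX0 l j (by have : (l : ℕ) < i := h; omega), mul_zero]
      · rw [hB.2.1 i l h, zero_mul]
    have h2 : (X * B) i j = X i j * B j j := by
      rw [Matrix.mul_apply]
      apply Finset.sum_eq_single_of_mem j (Finset.mem_univ _)
      intro l _ hl
      rcases lt_or_gt_of_ne hl with h | h
      · rw [hB.2.1 l j h, mul_zero]
      · rw [hX0 i l (by have : (j : ℕ) < l := h; omega), zero_mul]
    rw [Matrix.sub_apply, h1, h2]
    by_cases h : η.index i = η.index j
    · rw [hB.2.2 i j h, mul_comm, sub_self]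
    · rw [hX.1 i j h]; simp

lemma commute_of_commute_exp_of_mem_blockSubalgebra {B C : Matrix (Fin m) (Fin m) ℂ}
    (hB : B ∈ blockSubalgebra η) (hC : C ∈ blockSubalgebra η) (h : Commute (exp B) C) :
    Commute B C := by
  refine commute_of_commute_exp B C h m ?_
  ext i j
  exact (iterate_commutator_mem η hB hC m).2 i j (by omega)

end BlockAlgebra

/-! ### Affine maps as matrices -/

section Representation

variable {n : ℕ}

lemma apply_eq_linear_add (f : MA n) (x : Fin n → ℂ) : f x = f 0 + f.linear x := by
  have := f.map_vadd 0 x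
  simp only [vadd_eq_add, add_zero] at this
  rw [this, add_comm]

lemma blockMatrix_mulVec_cons (c : ℂ) (f : MA n) (z : ℂ) (x : Fin n → ℂ) :
    (blockMatrix c f).mulVec (Fin.cons z x) = Fin.cons (c * z) (z • f 0 + f.linear x) := by
  ext i
  refine Fin.cases ?_ (fun i => ?_) i
  · simp [blockMatrix, Matrix.mulVec, dotProduct, Fin.sum_univ_succ]
  · have h : (LinearMap.toMatrix' f.linear).mulVec x i = f.linear x i := by
      rw [LinearMap.toMatrix'_mulVec]
    simp only [Matrix.mulVec, dotProduct] at h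
    simp [blockMatrix, Matrix.mulVec, dotProduct, Fin.sum_univ_succ, -LinearMap.toMatrix'_apply, h,
      mul_comm z]

lemma Phi_mulVec (f : MA n) (x : Fin n → ℂ) :
    (Phi f).mulVec (Fin.cons 1 x) = Fin.cons 1 (f x) := by
  rw [Phi, blockMatrix_mulVec_cons, one_mul, one_smul, ← apply_eq_linear_add]

lemma Psi_mulVec (f : MA n) (x : Fin n → ℂ) :
    (Psi f).mulVec (Fin.cons 1 x) = Fin.cons 0 (f x) := by
  rw [Psi, blockMatrix_mulVec_cons, zero_mul, one_smul, ← apply_eq_linear_add]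

@[simp] lemma Phi_zero_zero (f : MA n) : Phi f 0 0 = 1 := rfl

@[simp] lemma Phi_zero_succ (f : MA n) (j : Fin n) : Phi f 0 j.succ = 0 := rfl

@[simp] lemma Psi_zero_apply (f : MA n) (j : Fin (n + 1)) : Psi f 0 j = 0 := by
  refine Fin.cases rfl (fun _ => rfl) j

lemma matrix_ext_mulVec_cons {M N : Matrix (Fin (n + 1)) (Fin (n + 1)) ℂ}
    (h : ∀ z x, M.mulVec (Fin.cons z x) = N.mulVec (Fin.cons z x)) : M = N := by
  apply Matrix.ext_of_mulVec_single
  intro i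
  have := h ((Pi.single i 1 : Fin (n + 1) → ℂ) 0) (Fin.tail (Pi.single i 1 : Fin (n + 1) → ℂ))
  rwa [Fin.cons_self_tail] at this

lemma Phi_mul (f g : MA n) : Phi (f * g) = Phi f * Phi g := by
  apply matrix_ext_mulVec_cons
  intro z x
  rw [← Matrix.mulVec_mulVec, Phi, Phi, Phi, blockMatrix_mulVec_cons, blockMatrix_mulVec_cons,
    blockMatrix_mulVec_cons]
  congr 1
  · simp
  · have h1 : (f * g) 0 = f 0 + f.linear (g 0) := apply_eq_linear_add f (g 0)
    have h2 : (f * g).linear x = f.linear (g.linear x) := rfl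
    rw [h1, h2, map_add, map_smul, smul_add, one_mul, add_assoc]

lemma Psi_add (f g : MA n) : Psi (f + g) = Psi f + Psi g := by
  apply matrix_ext_mulVec_cons
  intro z x
  rw [Matrix.add_mulVec, Psi, Psi, Psi, blockMatrix_mulVec_cons, blockMatrix_mulVec_cons,
    blockMatrix_mulVec_cons]
  ext i
  refine Fin.cases ?_ (fun i => ?_) i
  · simp
  · simp
    ring

lemma exists_blockMatrix_eq (c : ℂ) (M : Matrix (Fin (n + 1)) (Fin (n + 1)) ℂ) (h0 : M 0 0 = c)
    (h : ∀ j : Fin n, M 0 j.succ = 0) : ∃ f : MA n, blockMatrix c f = M := by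
  refine ⟨(Matrix.toLin' (M.submatrix Fin.succ Fin.succ)).toAffineMap +
    AffineMap.const ℂ _ (fun i => M i.succ 0), ?_⟩
  ext i j
  refine Fin.cases ?_ (fun i => ?_) i
  · refine Fin.cases ?_ (fun j => ?_) j
    · simp [blockMatrix, h0]
    · simp [blockMatrix, h]
  · refine Fin.cases ?_ (fun j => ?_) j
    · simp [blockMatrix]
    · simp [blockMatrix]

end Representation

/-! ### Density between affine maps and their logarithms -/

section Density

variable {n : ℕ} {A : Type*} [NormedRing A] [NormedAlgebra ℂ A]
  (ι : A →ₐ[ℂ] Matrix (Fin (n + 1)) (Fin (n + 1)) ℂ)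

lemma mulVec_cons_zero {M : Matrix (Fin (n + 1)) (Fin (n + 1)) ℂ}
    (h : ∀ j : Fin n, M 0 j.succ = 0) (z : ℂ) (x : Fin n → ℂ) :
    M.mulVec (Fin.cons z x) 0 = M 0 0 * z := by
  simp [Matrix.mulVec, dotProduct, Fin.sum_univ_succ, h]

/-- The corner entry as a character of an algebra of matrices with first row `(c, 0, …, 0)`. -/
def cornerCharacter (hrow : ∀ a, ∀ j : Fin n, ι a 0 j.succ = 0) : A →ₐ[ℂ] ℂ where
  toFun a := ι a 0 0
  map_one' := by simp
  map_mul' a b := by simp [Matrix.mul_apply, Fin.sum_univ_succ, hrow]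
  map_zero' := by simp
  map_add' a b := by simp
  commutes' z := by simp [Matrix.algebraMap_matrix_apply]

/-- Evaluation at `(1, w)` identifies a commutative matrix algebra having `(1, w)` as a cyclic
vector with the whole space. -/
noncomputable def evalEquiv (hι : Function.Injective ι) (hc : ∀ a b : A, a * b = b * a)
    (w : Fin n → ℂ) (hw : ∀ y, ∃ a, (ι a).mulVec (Fin.cons 1 w) = y) :
    A ≃ₗ[ℂ] (Fin (n + 1) → ℂ) :=
  LinearEquiv.ofBijective
    { toFun := fun a : A => (ι a).mulVec (Fin.cons 1 w)
      map_add' := fun a b => by simp [Matrix.add_mulVec]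
      map_smul' := fun z a => by simp [Matrix.smul_mulVec] }
    ⟨by
      -- By commutativity an element killing the cyclic vector `(1, w)` kills every `b (1, w)`,
      -- hence everything.
      rw [injective_iff_map_eq_zero]
      intro a ha
      replace ha : (ι a).mulVec (Fin.cons 1 w) = 0 := ha
      apply hι
      apply Matrix.ext_of_mulVec_single
      intro i
      obtain ⟨b, hbi⟩ := hw (Pi.single i 1)
      rw [← hbi, Matrix.mulVec_mulVec, ← map_mul, hc, map_mul, ← Matrix.mulVec_mulVec, ha]
      simp, hw⟩

lemma evalEquiv_apply (hι : Function.Injective ι) (hc : ∀ a b : A, a * b = b * a)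
    (w : Fin n → ℂ) (hw : ∀ y, ∃ a, (ι a).mulVec (Fin.cons 1 w) = y) (a : A) :
    evalEquiv ι hι hc w hw a = (ι a).mulVec (Fin.cons 1 w) := rfl

variable [FiniteDimensional ℂ A]

lemma map_exp_matrix (a : A) : ι (exp a) = exp (ι a) := by
  have : CompleteSpace A := FiniteDimensional.complete ℂ A
  exact map_exp_complex ι ι.toLinearMap.continuous_of_finiteDimensional a

variable (hι : Function.Injective ι) (hc : ∀ a b : A, a * b = b * a)
  (hrow : ∀ a, ∀ j : Fin n, ι a 0 j.succ = 0)
  (w : Fin n → ℂ) (hw : ∀ y, ∃ a, (ι a).mulVec (Fin.cons 1 w) = y)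

include hι hc hrow hw

omit [FiniteDimensional ℂ A] in
/-- A dense subset of `ℂⁿ` consisting of values at `w` gives a dense subset of an affine
hyperplane of the algebra. -/
lemma mem_closure_of_dense_orbit (c : ℂ) (S : Set (MA n)) (hS : Dense (orbit S w))
    (R : MA n → Matrix (Fin (n + 1)) (Fin (n + 1)) ℂ) (hRA : ∀ f ∈ S, R f ∈ ι.range)
    (hR : ∀ f, (R f).mulVec (Fin.cons 1 w) = Fin.cons c (f w)) (a : A)
    (ha : cornerCharacter ι hrow a = c) :
    a ∈ closure {b : A | ∃ f ∈ S, R f = ι b} := by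
  set e := evalEquiv ι hι hc w hw with he
  -- The map `z ↦ e⁻¹ (c, z)` parametrizes the hyperplane where the corner entry is `c`.
  have hg : Continuous fun z : Fin n → ℂ => e.symm (Fin.cons c z : Fin (n + 1) → ℂ) := by
    have h1 : Continuous e.symm := e.symm.toLinearMap.continuous_of_finiteDimensional
    refine h1.comp ?_
    refine continuous_pi fun i => ?_
    refine Fin.cases ?_ (fun i => ?_) i
    · exact continuous_const
    · exact continuous_apply i
  have hea : e a = Fin.cons c (Fin.tail (e a)) := by
    rw [← Fin.cons_self_tail (e a)]
    congr 1
    rw [he, evalEquiv_apply, mulVec_cons_zero (hrow a), mul_one]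
    exact ha
  have h2 := image_closure_subset_closure_image hg ⟨Fin.tail (e a), hS _, rfl⟩
  simp only [← hea, LinearEquiv.symm_apply_apply] at h2
  refine closure_mono ?_ h2
  rintro _ ⟨_, ⟨f, hf, rfl⟩, rfl⟩
  refine ⟨f, hf, ?_⟩
  obtain ⟨b, hb⟩ := hRA f hf
  have : b = e.symm (Fin.cons c (f w)) := by
    rw [LinearEquiv.eq_symm_apply, he, evalEquiv_apply, ← hR f, ← hb]
    rfl
  change R f = ι (e.symm (Fin.cons c (f w)))
  rw [← this]
  exact hb.symm

/-- Density passes from a set of affine maps to its affine logarithms. -/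
theorem dense_orbit_logs (S : Set (MA n)) (hSA : ∀ f ∈ S, Phi f ∈ ι.range) (hS : Dense (orbit S w)) :
    Dense (orbit {f : MA n | Psi f ∈ ι.range ∧ exp (Psi f) ∈ Phi '' S} w) := by
  intro y
  have : CompleteSpace A := FiniteDimensional.complete ℂ A
  set e := evalEquiv ι hι hc w hw with he
  set χ := cornerCharacter ι hrow with hχ
  have hq : Continuous fun a : A => Fin.tail (e a) := by
    have h1 : Continuous e := e.toLinearMap.continuous_of_finiteDimensional
    exact continuous_pi fun i => (continuous_apply i.succ).comp h1
  have ha : χ (e.symm (Fin.cons 0 y)) = 0 := by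
    have h1 : e (e.symm (Fin.cons 0 y)) 0 = 0 := by simp
    rw [he, evalEquiv_apply, mulVec_cons_zero (hrow _), mul_one] at h1
    exact h1
  have h1 := mem_closure_exp_preimage χ hc {b : A | ∃ f ∈ S, Phi f = ι b}
    (by
      rintro b ⟨f, hf, hfb⟩
      exact (congrFun (congrFun hfb.symm 0) 0 :))
    (mem_closure_of_dense_orbit ι hι hc hrow w hw 1 S hS Phi hSA (fun f => Phi_mulVec f w))
    (e.symm (Fin.cons 0 y)) ha
  have h2 := image_closure_subset_closure_image hq ⟨_, h1, rfl⟩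
  simp only [LinearEquiv.apply_symm_apply, Fin.tail_cons] at h2
  refine closure_mono ?_ h2
  rintro _ ⟨b, ⟨hb0, f, hf, hfb⟩, rfl⟩
  -- Since `χ b = 0`, the whole first row of `ι b` vanishes, so it is some `Psi g`.
  obtain ⟨g, hg⟩ := exists_blockMatrix_eq 0 (ι b) hb0
    (hrow b)
  have hg' : Psi g = (ι b) := hg
  refine ⟨g, ⟨⟨b, hg'.symm⟩, f, hf, ?_⟩, ?_⟩
  · rw [hfb, hg', map_exp_matrix]
  · simp only [he, evalEquiv_apply, ← hg', Psi_mulVec, Fin.tail_cons]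

/-- Density passes from a set of affine maps to its exponentials. -/
theorem dense_exp_orbit (T : Set (MA n)) (hTA : ∀ f ∈ T, Psi f ∈ ι.range) (hT : Dense (orbit T w)) :
    Dense {y | ∃ f ∈ T, (exp (Psi f)).mulVec (Fin.cons 1 w) = Fin.cons 1 y} := by
  intro y
  have : CompleteSpace A := FiniteDimensional.complete ℂ A
  set e := evalEquiv ι hι hc w hw with he
  set χ := cornerCharacter ι hrow with hχ
  have hq : Continuous fun a : A => Fin.tail (e a) := by
    have h1 : Continuous e := e.toLinearMap.continuous_of_finiteDimensional
    exact continuous_pi fun i => (continuous_apply i.succ).comp h1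
  have ha : χ (e.symm (Fin.cons 1 y)) = 1 := by
    have h1 : e (e.symm (Fin.cons 1 y)) 0 = 1 := by simp
    rw [he, evalEquiv_apply, mulVec_cons_zero (hrow _), mul_one] at h1
    exact h1
  have h1 := mem_closure_exp_image χ hc {b : A | ∃ f ∈ T, Psi f = ι b}
    (mem_closure_of_dense_orbit ι hι hc hrow w hw 0 T hT Psi hTA (fun f => Psi_mulVec f w))
    (e.symm (Fin.cons 1 y)) ha
  have h2 := image_closure_subset_closure_image hq ⟨_, h1, rfl⟩
  simp only [LinearEquiv.apply_symm_apply, Fin.tail_cons] at h2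
  refine closure_mono ?_ h2
  rintro _ ⟨_, ⟨b, ⟨f, hf, hfb⟩, rfl⟩, rfl⟩
  refine ⟨f, hf, ?_⟩
  have hχb : χ (exp b) = 1 := by
    have hb0 : χ b = 0 := (congrFun (congrFun hfb.symm 0) 0 :).trans (Psi_zero_apply f 0)
    rw [map_exp_complex χ (continuous_character χ), hb0, exp_zero]
  have hexp_b : ι (exp b) = exp (Psi f) := by rw [map_exp_matrix, hfb]
  change _ = Fin.cons 1 (Fin.tail (e (exp b)))
  rw [← hexp_b, ← evalEquiv_apply ι hι hc w hw, ← he]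
  refine (Fin.cons_self_tail (e (exp b))).symm.trans ?_
  congr 1
  rw [he, evalEquiv_apply, mulVec_cons_zero (hrow _), mul_one]
  exact hχb

end Density

/-! ### The conjugated block algebra and the vector `w₀` -/

section ConjugateBlockAlgebra

variable {n : ℕ}

lemma Phi_one : Phi (1 : MA n) = 1 := by
  apply matrix_ext_mulVec_cons
  intro z x
  rw [Phi, blockMatrix_mulVec_cons, Matrix.one_mulVec]
  congr 1
  · simp
  · change z • (0 : Fin n → ℂ) + x = x
    simp

lemma Phi_mul_Phi_symm (φ : GA n) : Phi (φ : MA n) * Phi (φ.symm : MA n) = 1 := by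
  rw [← Phi_mul, ← Phi_one]
  congr 1
  ext1 x
  exact φ.apply_symm_apply x

lemma isUnit_Phi (φ : GA n) : IsUnit (Phi (φ : MA n)) :=
  IsUnit.of_mul_eq_one _ (Phi_mul_Phi_symm φ)

lemma Phi_inv (φ : GA n) : (Phi (φ : MA n))⁻¹ = Phi (φ.symm : MA n) :=
  Matrix.inv_eq_right_inv (Phi_mul_Phi_symm φ)

/-- An affine map with invertible matrix is surjective. -/
lemma surjective_of_isUnit_Phi {f : MA n} (hf : IsUnit (Phi f)) : Function.Surjective f := by
  intro y
  have hdet := (Matrix.isUnit_iff_isUnit_det _).1 hf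
  set z := (Phi f)⁻¹.mulVec (Fin.cons 1 y) with hz
  have hfz : (Phi f).mulVec z = Fin.cons 1 y := by
    rw [hz, Matrix.mulVec_mulVec, Matrix.mul_nonsing_inv _ hdet, Matrix.one_mulVec]
  rw [← Fin.cons_self_tail z] at hfz
  have hz0 : z 0 = 1 := by
    have := congrFun hfz 0
    rwa [mulVec_cons_zero (Phi_zero_succ f), Phi_zero_zero, one_mul, Fin.cons_zero] at this
  rw [hz0, Phi_mulVec] at hfz
  exact ⟨_, (Fin.cons_inj.1 hfz).2⟩

lemma conj_mul {m : Type*} [Fintype m] [DecidableEq m] {P : Matrix m m ℂ} (hP : IsUnit P)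
    (M N : Matrix m m ℂ) : P⁻¹ * (M * N) * P = (P⁻¹ * M * P) * (P⁻¹ * N * P) := by
  have h : P * P⁻¹ = 1 := Matrix.mul_nonsing_inv _ ((Matrix.isUnit_iff_isUnit_det _).1 hP)
  calc P⁻¹ * (M * N) * P = P⁻¹ * M * 1 * N * P := by simp only [mul_assoc, one_mul]
    _ = _ := by rw [← h]; simp only [mul_assoc]

variable (η : Composition (n + 1)) (φ : GA n)

/-- The algebra `P (𝕋_{n₁}(ℂ) ⊕ ⋯ ⊕ 𝕋_{n_r}(ℂ)) P⁻¹` with `P = Φ(φ)`. -/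
def conjBlockSubalgebra : Subalgebra ℂ (Matrix (Fin (n + 1)) (Fin (n + 1)) ℂ) where
  carrier := {M | (Phi (φ : MA n))⁻¹ * M * Phi (φ : MA n) ∈ blockSubalgebra η}
  mul_mem' := by
    intro M N hM hN
    rw [Set.mem_ofPred_eq, conj_mul (isUnit_Phi φ)]
    exact mul_mem hM hN
  add_mem' := by
    intro M N hM hN
    rw [Set.mem_ofPred_eq, mul_add, add_mul]
    exact add_mem hM hN
  algebraMap_mem' := by
    intro z
    rw [Set.mem_ofPred_eq, ← Algebra.commutes, mul_assoc,
      Matrix.nonsing_inv_mul _ ((Matrix.isUnit_iff_isUnit_det _).1 (isUnit_Phi φ)), mul_one]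
    exact algebraMap_mem _ z

variable {η φ}

lemma mem_conjBlockSubalgebra {M : Matrix (Fin (n + 1)) (Fin (n + 1)) ℂ} :
    M ∈ conjBlockSubalgebra η φ ↔
      (Phi (φ : MA n))⁻¹ * M * Phi (φ : MA n) ∈ blockSubalgebra η := Iff.rfl

lemma mem_conjBlockSubalgebra_iff_mem_image {M : Matrix (Fin (n + 1)) (Fin (n + 1)) ℂ} :
    M ∈ conjBlockSubalgebra η φ ↔
      M ∈ (fun M => Phi (φ : MA n) * M * (Phi (φ : MA n))⁻¹) '' blockAlgebra η := by
  have hu := (Matrix.isUnit_iff_isUnit_det _).1 (isUnit_Phi φ)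
  constructor
  · intro h
    refine ⟨_, h, ?_⟩
    simp only [mul_assoc, Matrix.mul_nonsing_inv _ hu, mul_one]
    rw [← mul_assoc, Matrix.mul_nonsing_inv _ hu, one_mul]
  · rintro ⟨K, hK, rfl⟩
    rw [mem_conjBlockSubalgebra]
    simp only [mul_assoc, Matrix.nonsing_inv_mul _ hu, mul_one]
    rw [← mul_assoc, Matrix.nonsing_inv_mul _ hu, one_mul]
    exact hK

lemma mul_zero_succ {M N : Matrix (Fin (n + 1)) (Fin (n + 1)) ℂ}
    (hM : ∀ j : Fin n, M 0 j.succ = 0) (hN : ∀ j : Fin n, N 0 j.succ = 0) (j : Fin n) :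
    (M * N) 0 j.succ = 0 := by
  simp [Matrix.mul_apply, Fin.sum_univ_succ, hM, hN]

lemma zero_succ_of_mem_conjBlockSubalgebra {M : Matrix (Fin (n + 1)) (Fin (n + 1)) ℂ}
    (hM : M ∈ conjBlockSubalgebra η φ) (j : Fin n) : M 0 j.succ = 0 := by
  obtain ⟨K, hK, rfl⟩ := mem_conjBlockSubalgebra_iff_mem_image.1 hM
  rw [Phi_inv]
  exact mul_zero_succ (mul_zero_succ (Phi_zero_succ _) (fun j => hK.2.1 _ _ (Fin.succ_pos j)))
    (Phi_zero_succ _) j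

lemma commute_of_commute_exp_of_mem_conjBlockSubalgebra
    {B C : Matrix (Fin (n + 1)) (Fin (n + 1)) ℂ} (hB : B ∈ conjBlockSubalgebra η φ)
    (hC : C ∈ conjBlockSubalgebra η φ) (h : Commute (exp B) C) : Commute B C := by
  have hP := isUnit_Phi φ
  have hu := (Matrix.isUnit_iff_isUnit_det _).1 hP
  have h1 := commute_of_commute_exp_of_mem_blockSubalgebra η hB hC (by
    rw [Matrix.exp_conj' _ _ hP]
    change _ * _ = _ * _
    rw [← conj_mul hP, ← conj_mul hP, h.eq])
  change _ * _ = _ * _ at h1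
  rw [← conj_mul hP, ← conj_mul hP] at h1
  have h2 := congrArg (fun M => Phi (φ : MA n) * M * (Phi (φ : MA n))⁻¹) h1
  simp only [mul_assoc, Matrix.mul_nonsing_inv _ hu, mul_one] at h2
  simp only [← mul_assoc, Matrix.mul_nonsing_inv _ hu, one_mul] at h2
  exact h2

lemma u₀_zero (η : Composition (n + 1)) : u₀ η 0 = 1 := by
  simp [u₀]

/-- The first row of `P` is `(1, 0, …, 0)` and `u₀` starts with `1`, so dropping the first
coordinate of `P u₀` loses nothing. -/
lemma cons_w₀ : (Fin.cons 1 (w₀ η φ) : Fin (n + 1) → ℂ) = (Phi (φ : MA n)).mulVec (u₀ η) := by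
  refine Eq.trans ?_ (Fin.cons_self_tail _)
  congr 1
  rw [← Fin.cons_self_tail (u₀ η), mulVec_cons_zero (Phi_zero_succ _), u₀_zero]
  simp

/-- A matrix of the block algebra with `u₀` in its range is invertible. -/
lemma isUnit_of_mulVec_eq_u₀ {m : ℕ} {η : Composition m} {K : Matrix (Fin m) (Fin m) ℂ}
    (hK : K ∈ blockSubalgebra η) (x : Fin m → ℂ) (hx : K.mulVec x = u₀ η) : IsUnit K := by
  have hdiag : ∀ i, K i i ≠ 0 := by
    intro i
    -- `i₀` opens the block of `i`, so row `i₀` of `K` has only its diagonal entry, and `1 = K i₀ i₀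
    -- * x i₀`.
    set i₀ := η.embedding (η.index i) ⟨0, η.one_le_blocksFun _⟩ with hi₀
    have hidx : η.index i₀ = η.index i := η.index_embedding _ _
    rw [hK.2.2 i i₀ hidx.symm]
    have h1 : K.mulVec x i₀ = K i₀ i₀ * x i₀ := by
      rw [Matrix.mulVec, dotProduct]
      apply Finset.sum_eq_single_of_mem i₀ (Finset.mem_univ _)
      intro l _ hl
      by_cases h : η.index i₀ = η.index l
      · rcases lt_or_gt_of_ne hl with hlt | hlt
        · exfalso
          have h2 := η.sizeUpTo_index_le l
          have h3 : (l : ℕ) < i₀ := hlt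
          have h4 : (i₀ : ℕ) = η.sizeUpTo (η.index i) := by simp [hi₀]
          rw [← h, hidx] at h2
          omega
        · rw [hK.2.1 _ _ hlt, zero_mul]
      · rw [hK.1 _ _ h, zero_mul]
    have h2 : u₀ η i₀ = 1 := by
      rw [u₀, if_pos]
      exact η.invEmbedding_comp _ _
    intro h0
    rw [hx, h2, h0, zero_mul] at h1
    exact one_ne_zero h1
  rw [Matrix.isUnit_iff_isUnit_det, Matrix.det_of_isLowerTriangular K (fun i j hij => hK.2.1 i j hij),
    isUnit_iff_ne_zero]
  exact Finset.prod_ne_zero_iff.2 fun i _ => hdiag i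

end ConjugateBlockAlgebra

/-! ### The equivalent conditions -/

section Equivalences

variable {n : ℕ}

/-- An algebra containing enough matrices to move `(1, w)` densely in an affine hyperplane has
`(1, w)` as a cyclic vector. -/
lemma exists_mulVec_eq_of_dense (A : Subalgebra ℂ (Matrix (Fin (n + 1)) (Fin (n + 1)) ℂ))
    (S : Set (MA n)) (w : Fin n → ℂ) (hS : Dense (orbit S w)) (c : ℂ)
    (R : MA n → Matrix (Fin (n + 1)) (Fin (n + 1)) ℂ) (hRA : ∀ f ∈ S, R f ∈ A)
    (hR : ∀ f, (R f).mulVec (Fin.cons 1 w) = Fin.cons c (f w)) (y : Fin (n + 1) → ℂ) :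
    ∃ M ∈ A, Matrix.mulVec M (Fin.cons 1 w) = y := by
  let ev : Matrix (Fin (n + 1)) (Fin (n + 1)) ℂ →ₗ[ℂ] (Fin (n + 1) → ℂ) :=
    { toFun := fun M => M.mulVec (Fin.cons 1 w)
      map_add' := fun M N => Matrix.add_mulVec _ _ _
      map_smul' := fun z M => Matrix.smul_mulVec _ _ _ }
  set p := A.toSubmodule.map ev with hp
  have hclosed : IsClosed (p : Set (Fin (n + 1) → ℂ)) := p.closed_of_finiteDimensional
  have hcont : Continuous fun z : Fin n → ℂ => (Fin.cons c z : Fin (n + 1) → ℂ) := by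
    refine continuous_pi fun i => ?_
    refine Fin.cases ?_ (fun i => ?_) i
    · exact continuous_const
    · exact continuous_apply i
  have h1 : ∀ z : Fin n → ℂ, (Fin.cons c z : Fin (n + 1) → ℂ) ∈ p := by
    intro z
    have h := image_closure_subset_closure_image hcont ⟨z, hS z, rfl⟩
    refine closure_minimal ?_ hclosed h
    rintro _ ⟨_, ⟨f, hf, rfl⟩, rfl⟩
    exact ⟨R f, hRA f hf, hR f⟩
  have hu : (Fin.cons 1 w : Fin (n + 1) → ℂ) ∈ p := ⟨1, one_mem A, Matrix.one_mulVec _⟩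
  -- The slice of vectors with first coordinate `c` lies in `p`; its differences fill first
  -- coordinate `0` for any `c`, and `(1, w)` supplies the missing direction.
  have hy : y = y 0 • (Fin.cons 1 w : Fin (n + 1) → ℂ) +
      ((Fin.cons c (Fin.tail y - y 0 • w) : Fin (n + 1) → ℂ) - Fin.cons c 0) := by
    ext i
    refine Fin.cases ?_ (fun i => ?_) i
    · simp
    · simp [Fin.tail]
  rw [hy]
  exact p.add_mem (p.smul_mem _ hu) (p.sub_mem (h1 _) (h1 _))

lemma adjoin_mul_comm {R : Type*} [Ring R] [Algebra ℂ R] {s : Set R}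
    (hs : ∀ a ∈ s, ∀ b ∈ s, Commute a b) (a b : Algebra.adjoin ℂ s) : a * b = b * a := by
  apply Subtype.ext
  have h1 : ∀ c ∈ s, Commute c (a : R) := fun c hc =>
    Algebra.commute_of_mem_adjoin_of_forall_mem_commute a.2 (fun d hd => hs c hc d hd)
  exact (Algebra.commute_of_mem_adjoin_of_forall_mem_commute b.2 (fun d hd => (h1 d hd).symm)).eq

variable {𝒢 : Subsemigroup (MA n)} {η : Composition (n + 1)} {φ : GA n}

lemma mem_affineLogs {f : MA n} : f ∈ affineLogs 𝒢 η φ ↔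
    exp (Psi f) ∈ Phi '' (𝒢 : Set (MA n)) ∧ Psi f ∈ conjBlockSubalgebra η φ := by
  rw [mem_conjBlockSubalgebra_iff_mem_image]
  exact ⟨fun h => h.1, fun h => ⟨h, f, rfl⟩⟩

variable (hab : ∀ f ∈ 𝒢, ∀ g ∈ 𝒢, f * g = g * f) (hnf : IsNormalForm 𝒢 η φ)

include hab in
lemma commute_Phi {f g : MA n} (hf : f ∈ 𝒢) (hg : g ∈ 𝒢) : Commute (Phi f) (Phi g) := by
  rw [Commute, SemiconjBy, ← Phi_mul, ← Phi_mul, hab f hf g hg]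

include hab hnf in
/-- The affine logarithms of an abelian semigroup commute. -/
lemma commute_Psi_of_mem_affineLogs {f g : MA n} (hf : f ∈ affineLogs 𝒢 η φ)
    (hg : g ∈ affineLogs 𝒢 η φ) : Commute (Psi f) (Psi g) := by
  obtain ⟨⟨f', hf', hff'⟩, hfB⟩ := mem_affineLogs.1 hf
  obtain ⟨⟨g', hg', hgg'⟩, hgB⟩ := mem_affineLogs.1 hg
  -- The logarithms are taken off one at a time: `Phi g'` commutes with `Phi f'`, so `Psi g` does,
  -- so `Psi f` commutes with `Psi g`.
  refine commute_of_commute_exp_of_mem_conjBlockSubalgebra hfB hgB ?_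
  rw [← hff']
  refine (commute_of_commute_exp_of_mem_conjBlockSubalgebra hgB (hnf f' hf') ?_).symm
  rw [← hgg']
  exact commute_Phi hab hg' hf'

include hab hnf in
-- As the logarithms commute, the exponential of a sum is a product in `Φ(𝒢)`.
lemma exists_addSubsemigroup_eq_orbit (w : Fin n → ℂ) : ∃ Q : AddSubsemigroup (Fin n → ℂ),
    (Q : Set (Fin n → ℂ)) = orbit (affineLogs 𝒢 η φ) w := by
  refine ⟨⟨orbit (affineLogs 𝒢 η φ) w, ?_⟩, rfl⟩
  rintro _ _ ⟨f, hf, rfl⟩ ⟨g, hg, rfl⟩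
  refine ⟨f + g, ?_, rfl⟩
  obtain ⟨⟨f', hf', hff'⟩, hfB⟩ := mem_affineLogs.1 hf
  obtain ⟨⟨g', hg', hgg'⟩, hgB⟩ := mem_affineLogs.1 hg
  refine mem_affineLogs.2 ⟨⟨f' * g', 𝒢.mul_mem hf' hg', ?_⟩, ?_⟩
  · rw [Psi_add, Matrix.exp_add_of_commute _ _ (commute_Psi_of_mem_affineLogs hab hnf hf hg),
      Phi_mul, hff', hgg']
  · rw [Psi_add]
    exact add_mem hfB hgB

include hnf in
lemma adjoin_Phi_le : Algebra.adjoin ℂ (Phi '' (𝒢 : Set (MA n))) ≤ conjBlockSubalgebra η φ := by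
  apply Algebra.adjoin_le
  rintro _ ⟨f, hf, rfl⟩
  exact hnf f hf

include hab in
lemma adjoin_Phi_mul_comm (a b : Algebra.adjoin ℂ (Phi '' (𝒢 : Set (MA n)))) : a * b = b * a :=
  adjoin_mul_comm (by
    rintro _ ⟨f, hf, rfl⟩ _ ⟨g, hg, rfl⟩
    exact commute_Phi hab hf hg) a b

include hab hnf in
/-- A dense orbit at `w` gives a dense set of values at `w` of the affine logarithms. -/
lemma dense_orbit_affineLogs (w : Fin n → ℂ) (hd : Dense (orbit (𝒢 : Set (MA n)) w)) :
    Dense (orbit (affineLogs 𝒢 η φ) w) := by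
  set A := Algebra.adjoin ℂ (Phi '' (𝒢 : Set (MA n))) with hA
  have hmem : ∀ f ∈ (𝒢 : Set (MA n)), Phi f ∈ A := fun f hf =>
    Algebra.subset_adjoin ⟨f, hf, rfl⟩
  have h := dense_orbit_logs A.val Subtype.val_injective (adjoin_Phi_mul_comm hab)
    (fun a j => zero_succ_of_mem_conjBlockSubalgebra (adjoin_Phi_le hnf a.2) j) w
    (fun y => by
      obtain ⟨M, hM, h⟩ := exists_mulVec_eq_of_dense A 𝒢 w hd 1 Phi hmem
        (fun f => Phi_mulVec f w) y
      exact ⟨⟨M, hM⟩, h⟩)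
    𝒢 (fun f hf => ⟨⟨Phi f, hmem f hf⟩, rfl⟩) hd
  refine h.mono ?_
  rintro _ ⟨f, ⟨⟨a, ha⟩, hf⟩, rfl⟩
  exact ⟨f, mem_affineLogs.2 ⟨hf, adjoin_Phi_le hnf (ha ▸ a.2)⟩, rfl⟩

include hab hnf in
/-- A dense set of values at `w` of the affine logarithms gives a dense orbit at `w`. -/
lemma dense_orbit_of_dense_orbit_affineLogs (w : Fin n → ℂ)
    (hd : Dense (orbit (affineLogs 𝒢 η φ) w)) : Dense (orbit (𝒢 : Set (MA n)) w) := by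
  -- The generators are now the logarithms, as the adjoined algebra of `Φ(𝒢)` is not known to
  -- contain them.
  set A := Algebra.adjoin ℂ (Psi '' (affineLogs 𝒢 η φ)) with hA
  have hmem : ∀ f ∈ affineLogs 𝒢 η φ, Psi f ∈ A := fun f hf =>
    Algebra.subset_adjoin ⟨f, hf, rfl⟩
  have hle : A ≤ conjBlockSubalgebra η φ := by
    apply Algebra.adjoin_le
    rintro _ ⟨f, hf, rfl⟩
    exact (mem_affineLogs.1 hf).2
  have h := dense_exp_orbit A.val Subtype.val_injective
    (adjoin_mul_comm (by
      rintro _ ⟨f, hf, rfl⟩ _ ⟨g, hg, rfl⟩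
      exact commute_Psi_of_mem_affineLogs hab hnf hf hg))
    (fun a j => zero_succ_of_mem_conjBlockSubalgebra (hle a.2) j) w
    (fun y => by
      obtain ⟨M, hM, h⟩ := exists_mulVec_eq_of_dense A _ w hd 0 Psi hmem
        (fun f => Psi_mulVec f w) y
      exact ⟨⟨M, hM⟩, h⟩)
    _ (fun f hf => ⟨⟨Psi f, hmem f hf⟩, rfl⟩) hd
  refine h.mono ?_
  rintro y ⟨f, hf, hy⟩
  obtain ⟨⟨g, hg, hgf⟩, -⟩ := mem_affineLogs.1 hf
  refine ⟨g, hg, ?_⟩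
  rw [← hgf, Phi_mulVec] at hy
  exact (Fin.cons_inj.1 hy).2

include hab hnf in
/-- For a hypercyclic abelian semigroup the orbit of `w₀` is dense. -/
lemma dense_orbit_w₀ (h : IsHypercyclic 𝒢) : Dense (orbit (𝒢 : Set (MA n)) (w₀ η φ)) := by
  obtain ⟨x, hx⟩ := h
  set A := Algebra.adjoin ℂ (Phi '' (𝒢 : Set (MA n))) with hA
  have hmem : ∀ f ∈ (𝒢 : Set (MA n)), Phi f ∈ A := fun f hf =>
    Algebra.subset_adjoin ⟨f, hf, rfl⟩
  obtain ⟨B, hBA, hB⟩ := exists_mulVec_eq_of_dense A 𝒢 x hx 1 Phi hmem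
    (fun f => Phi_mulVec f x) (Fin.cons 1 (w₀ η φ))
  have hBK := adjoin_Phi_le hnf hBA
  have hrow := zero_succ_of_mem_conjBlockSubalgebra hBK
  have hP := isUnit_Phi φ
  have hu := (Matrix.isUnit_iff_isUnit_det _).1 hP
  have hBu : IsUnit B := by
    have h1 := isUnit_of_mulVec_eq_u₀ hBK ((Phi (φ : MA n))⁻¹.mulVec (Fin.cons 1 x)) (by
      rw [Matrix.mulVec_mulVec, mul_assoc, Matrix.mul_nonsing_inv _ hu, mul_one,
        ← Matrix.mulVec_mulVec, hB, cons_w₀, Matrix.mulVec_mulVec, Matrix.nonsing_inv_mul _ hu,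
        Matrix.one_mulVec])
    have h2 : B = Phi (φ : MA n) * ((Phi (φ : MA n))⁻¹ * B * Phi (φ : MA n)) *
        (Phi (φ : MA n))⁻¹ := by
      simp only [mul_assoc, Matrix.mul_nonsing_inv _ hu, mul_one]
      rw [← mul_assoc, Matrix.mul_nonsing_inv _ hu, one_mul]
    rw [h2]
    exact (hP.mul h1).mul (Matrix.isUnit_nonsing_inv_iff.2 hP)
  have hB00 : B 0 0 = 1 := by
    have := congrFun hB 0
    rwa [mulVec_cons_zero hrow, mul_one, Fin.cons_zero] at this
  obtain ⟨β, hβ⟩ := exists_blockMatrix_eq 1 B hB00 hrow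
  replace hβ : Phi β = B := hβ
  have hβx : β x = w₀ η φ := by
    rw [← hβ, Phi_mulVec] at hB
    exact (Fin.cons_inj.1 hB).2
  have hβs : Function.Surjective β := surjective_of_isUnit_Phi (hβ ▸ hBu)
  -- `β` is continuous and onto, so it maps the dense orbit of `x` to a dense set; as it commutes
  -- with `𝒢`, that set lies in the orbit of `β x = w₀`.
  have hd := hβs.denseRange.dense_image β.continuous_of_finiteDimensional hx
  refine hd.mono ?_
  rintro _ ⟨_, ⟨f, hf, rfl⟩, rfl⟩
  refine ⟨f, hf, ?_⟩
  have hcomm : Phi f * Phi β = Phi β * Phi f := by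
    have := adjoin_Phi_mul_comm hab ⟨Phi f, hmem f hf⟩ ⟨B, hBA⟩
    rw [hβ]
    exact congrArg Subtype.val this
  have := congrArg (fun M => Matrix.mulVec M (Fin.cons 1 x)) hcomm
  simp only [← Matrix.mulVec_mulVec, Phi_mulVec] at this
  rw [← hβx]
  exact (Fin.cons_inj.1 this).2

include hab hnf in
theorem tfae_of_isNormalForm : List.TFAE [
    IsHypercyclic 𝒢,
    Dense (orbit (𝒢 : Set (MA n)) (w₀ η φ)),
    (∃ Q : AddSubsemigroup (Fin n → ℂ),
      (Q : Set (Fin n → ℂ)) = orbit (affineLogs 𝒢 η φ) (w₀ η φ)) ∧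
      Dense (orbit (affineLogs 𝒢 η φ) (w₀ η φ))] := by
  tfae_have 1 → 2 := dense_orbit_w₀ hab hnf
  tfae_have 2 → 1 := fun h => ⟨_, h⟩
  tfae_have 2 → 3 := fun h =>
    ⟨exists_addSubsemigroup_eq_orbit hab hnf _, dense_orbit_affineLogs hab hnf _ h⟩
  tfae_have 3 → 2 := fun h => dense_orbit_of_dense_orbit_affineLogs hab hnf _ h.2
  tfae_finish

end Equivalences

/-! ### Simultaneous triangularization -/

section Triangular

variable {V : Type*} [AddCommGroup V] [Module ℂ V] {ι : Type*} (f : ι → End ℂ V) (χ : ι → ℂ)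

/-- `b` is a basis of `W` in which every `f i` is lower triangular with constant diagonal `χ i`. -/
def IsLowerBasis (W : Submodule ℂ V) {d : ℕ} (b : Fin d → V) : Prop :=
  LinearIndependent ℂ b ∧ Submodule.span ℂ (Set.range b) = W ∧
    ∀ i j, f i (b j) - χ i • b j ∈ Submodule.span ℂ (b '' Set.Ioi j)

variable {f χ}

/-- The new vector goes in front: lower triangularity asks only that `f i y - χ i • y` lie in the
span of the later vectors, which is `H`. -/
lemma IsLowerBasis.cons {H W : Submodule ℂ V} {d : ℕ} {b : Fin d → V}
    (hb : IsLowerBasis f χ H b) (hHW : H ≤ W) {y : V} (hyW : y ∈ W) (hyH : y ∉ H)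
    (hW : W ≤ H ⊔ Submodule.span ℂ {y}) (hy : ∀ i, f i y - χ i • y ∈ H) :
    IsLowerBasis f χ W (Fin.cons y b : Fin (d + 1) → V) := by
  obtain ⟨h1, h2, h3⟩ := hb
  refine ⟨linearIndependent_finCons.2 ⟨h1, h2 ▸ hyH⟩, ?_, fun i j => ?_⟩
  · rw [Fin.range_cons, Submodule.span_insert, h2, sup_comm]
    exact le_antisymm (sup_le hHW (by simpa using hyW)) hW
  · refine Fin.cases ?_ (fun j => ?_) j
    · rw [Fin.cons_zero]
      refine Submodule.span_mono ?_ (h2.symm ▸ hy i)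
      rintro _ ⟨l, rfl⟩
      exact ⟨l.succ, Fin.succ_pos l, rfl⟩
    · rw [Fin.cons_succ]
      refine Submodule.span_mono ?_ (h3 i j)
      rintro _ ⟨l, hl, rfl⟩
      exact ⟨l.succ, Fin.succ_lt_succ_iff.2 hl, rfl⟩

/-- A commuting family has a lower triangular basis on every invariant subspace on which each
member has a single generalized eigenvalue. -/
lemma exists_isLowerBasis [FiniteDimensional ℂ V] (hcomm : ∀ i j, Commute (f i) (f j))
    (W : Submodule ℂ V) (hinv : ∀ i, ∀ x ∈ W, f i x ∈ W)
    (hnil : ∀ i, ∃ k, ∀ x ∈ W, ((f i - algebraMap ℂ (End ℂ V) (χ i)) ^ k) x = 0) :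
    ∃ (d : ℕ) (b : Fin d → V), IsLowerBasis f χ W b := by
  induction W using WellFoundedLT.induction with
  | ind W ih =>
  by_cases hbot : W = ⊥
  · subst hbot
    refine ⟨0, Fin.elim0, linearIndependent_empty_type, ?_, fun i j => j.elim0⟩
    rw [Set.range_eq_empty, Submodule.span_empty]
  obtain ⟨H, ⟨hHW, hHinv⟩, hmax⟩ := WellFounded.has_min
    (wellFounded_gt (α := Submodule ℂ V))
    {H : Submodule ℂ V | H < W ∧ ∀ i, ∀ x ∈ H, f i x ∈ H}
    ⟨⊥, bot_lt_iff_ne_bot.2 hbot, fun i x hx => by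
      rw [Submodule.mem_bot] at hx ⊢; rw [hx, map_zero]⟩
  have hmax' : ∀ H' : Submodule ℂ V, H ≤ H' → H' ≤ W → (∀ i, ∀ x ∈ H', f i x ∈ H') →
      H' ≠ W → H' = H := by
    intro H' h1 h2 h3 h4
    by_contra hne
    exact hmax H' ⟨lt_of_le_of_ne h2 h4, h3⟩ (lt_of_le_of_ne h1 (Ne.symm hne))
  set N : ι → End ℂ V := fun i => f i - algebraMap ℂ (End ℂ V) (χ i) with hN
  have hNapp : ∀ i x, N i x = f i x - χ i • x := fun i x => by simp [hN, Module.algebraMap_end_apply]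
  -- By maximality of `H`, the invariant subspace `H + N i W` is `H` or `W`. In the latter case
  -- iteration gives `W = H + (N i)^k W`, which is `H` by nilpotency.
  have hNW : ∀ i, ∀ x ∈ W, N i x ∈ H := by
    intro i x hx
    have hWN : W.map (N i) ≤ W := by
      rintro _ ⟨z, hz, rfl⟩
      rw [hNapp]
      exact W.sub_mem (hinv i z hz) (W.smul_mem _ hz)
    have hHN : H.map (N i) ≤ H := by
      rintro _ ⟨z, hz, rfl⟩
      rw [hNapp]
      exact H.sub_mem (hHinv i z hz) (H.smul_mem _ hz)
    have hinv' : ∀ j, ∀ z ∈ H ⊔ W.map (N i), f j z ∈ H ⊔ W.map (N i) := by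
      intro j z hz
      obtain ⟨u, hu, v, ⟨t, ht, rfl⟩, rfl⟩ := Submodule.mem_sup.1 hz
      rw [map_add]
      refine Submodule.add_mem_sup (hHinv j u hu) ⟨f j t, hinv j t ht, ?_⟩
      rw [hNapp, hNapp, map_sub, map_smul]
      congr 1
      exact LinearMap.congr_fun (hcomm i j).eq t
    have hne : H ⊔ W.map (N i) ≠ W := by
      intro heq
      have hk : ∀ k, W ≤ H ⊔ W.map (N i ^ k) := by
        intro k
        induction k with
        | zero =>
          intro z hz
          exact Submodule.mem_sup_right ⟨z, hz, by simp⟩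
        | succ k ihk =>
          calc W = H ⊔ W.map (N i) := heq.symm
            _ ≤ H ⊔ (H ⊔ W.map (N i ^ k)).map (N i) := by gcongr
            _ ≤ H ⊔ W.map (N i ^ (k + 1)) := by
              rw [Submodule.map_sup, ← Submodule.map_comp, pow_succ']
              exact sup_le le_sup_left (sup_le (hHN.trans le_sup_left) le_sup_right)
      obtain ⟨k, hk0⟩ := hnil i
      apply hHW.not_ge
      refine (hk k).trans (sup_le le_rfl ?_)
      rintro _ ⟨z, hz, rfl⟩
      rw [hk0 z hz]
      exact H.zero_mem
    have := hmax' _ le_sup_left (sup_le hHW.le hWN) hinv' hne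
    rw [← this]
    exact Submodule.mem_sup_right ⟨x, hx, rfl⟩
  obtain ⟨y, hyW, hyH⟩ := SetLike.exists_of_lt hHW
  obtain ⟨d, b, hb⟩ := ih H hHW hHinv fun i => by
    obtain ⟨k, hk⟩ := hnil i
    exact ⟨k, fun x hx => hk x (hHW.le hx)⟩
  refine ⟨d + 1, Fin.cons y b, hb.cons hHW.le hyW hyH ?_ fun i => hNapp i y ▸ hNW i y hyW⟩
  -- Since `N i` maps `W` into `H`, adding `y` to `H` gives an invariant subspace; maximality makes
  -- it all of `W`.
  by_contra hlt
  refine hyH ?_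
  rw [← hmax' (H ⊔ Submodule.span ℂ {y}) le_sup_left (sup_le hHW.le (by simpa using hyW)) ?_
    (fun h => hlt h.ge)]
  · exact Submodule.mem_sup_right (Submodule.mem_span_singleton_self y)
  · intro i z hz
    have hzW : z ∈ W := (sup_le hHW.le (by simpa using hyW) : H ⊔ Submodule.span ℂ {y} ≤ W) hz
    have : f i z = N i z + χ i • z := by rw [hNapp, sub_add_cancel]
    rw [this]
    exact Submodule.add_mem _ (Submodule.mem_sup_left (hNW i z hzW)) (Submodule.smul_mem _ _ hz)

lemma IsLowerBasis.card_eq {W : Submodule ℂ V} {d : ℕ} {b : Fin d → V}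
    (hb : IsLowerBasis f χ W b) : d = finrank ℂ W := by
  rw [← hb.2.1, finrank_span_eq_card hb.1, Fintype.card_fin]

/-- Lower triangular bases of the summands of an internal direct sum assemble to a basis in which
the matrices of the family lie in the block algebra. -/
lemma exists_basis_toMatrix_mem_blockAlgebra {m : ℕ} (c : Composition m)
    (W : Fin c.length → Submodule ℂ V) (hW : DirectSum.IsInternal W)
    (χ : Fin c.length → ι → ℂ) (b : ∀ k, Fin (c.blocksFun k) → V)
    (hb : ∀ k, IsLowerBasis f (χ k) (W k) (b k)) :
    ∃ B : Basis (Fin m) ℂ V, (∀ j, B j = b (c.index j) (c.invEmbedding j)) ∧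
      ∀ i, LinearMap.toMatrix B B (f i) ∈ blockAlgebra c := by
  let v : ∀ k, Basis (Fin (c.blocksFun k)) ℂ (W k) := fun k =>
    (Basis.span (hb k).1).map (LinearEquiv.ofEq _ _ (hb k).2.1)
  have hv : ∀ k j, (v k j : V) = b k j := by
    intro k j
    simp [v, Basis.span_apply]
  let B := (hW.collectedBasis v).reindex c.blocksFinEquiv
  have hBp : ∀ p, B (c.blocksFinEquiv p) = b p.1 p.2 := by
    intro p
    simp only [B, Basis.reindex_apply, Equiv.symm_apply_apply, DirectSum.IsInternal.collectedBasis_coe,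
      hv]
  have hB : ∀ j, B j = b (c.index j) (c.invEmbedding j) := by
    intro j
    rw [← hBp ⟨c.index j, c.invEmbedding j⟩]
    congr 1
    exact (c.embedding_comp_inv j).symm
  have hspan : ∀ i j, f i (B j) - χ (c.index j) i • B j ∈
      Submodule.span ℂ (B '' {l | c.index l = c.index j ∧ j < l}) := by
    intro i j
    rw [hB]
    refine Submodule.span_mono ?_ ((hb (c.index j)).2.2 i (c.invEmbedding j))
    rintro _ ⟨l, hl, rfl⟩
    refine ⟨c.embedding (c.index j) l, ⟨c.index_embedding _ _, ?_⟩, hBp ⟨c.index j, l⟩⟩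
    conv_lhs => rw [← c.embedding_comp_inv j]
    exact (c.embedding (c.index j)).strictMono hl
  have hzero : ∀ i l j, ¬(c.index l = c.index j ∧ j < l) →
      B.repr (f i (B j) - χ (c.index j) i • B j) l = 0 := by
    intro i l j hlj
    have hle : Submodule.span ℂ (B '' {l | c.index l = c.index j ∧ j < l}) ≤
        LinearMap.ker (B.coord l) := by
      rw [Submodule.span_le]
      rintro _ ⟨l', hl', rfl⟩
      rw [SetLike.mem_coe, LinearMap.mem_ker, Basis.coord_apply, Basis.repr_self,
        Finsupp.single_apply, if_neg]
      rintro rfl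
      exact hlj hl'
    exact hle (hspan i j)
  have hentry : ∀ i l j, ¬(c.index l = c.index j ∧ j < l) →
      LinearMap.toMatrix B B (f i) l j = if j = l then χ (c.index j) i else 0 := by
    intro i l j hlj
    have := hzero i l j hlj
    rw [map_sub, map_smul, Basis.repr_self, Finsupp.sub_apply, Finsupp.smul_apply,
      Finsupp.single_apply, sub_eq_zero] at this
    rw [LinearMap.toMatrix_apply, this]
    simp
  refine ⟨B, hB, fun i => ⟨fun l j hlj => ?_, fun l j hlj => ?_, fun l j hlj => ?_⟩⟩
  · rw [hentry i l j (fun h => hlj h.1), if_neg]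
    rintro rfl
    exact hlj rfl
  · rw [hentry i l j (fun h => h.2.not_gt hlj), if_neg hlj.ne']
  · rw [hentry i l l (fun h => h.2.false), hentry i j j (fun h => h.2.false), if_pos rfl, if_pos rfl,
      hlj]

lemma exists_composition_blocksFun {r m : ℕ} (d : Fin r → ℕ) (hd : ∀ k, 0 < d k)
    (hsum : ∑ k, d k = m) : ∃ (c : Composition m) (h : c.length = r),
      ∀ k, c.blocksFun k = d (Fin.cast h k) := by
  refine ⟨⟨List.ofFn d, ?_, ?_⟩, by simp [Composition.length], fun k => ?_⟩
  · intro i hi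
    obtain ⟨k, rfl⟩ := (List.mem_ofFn' d i).1 hi
    exact hd k
  · rw [List.sum_ofFn, hsum]
  · simp [Composition.blocksFun]
    rfl

end Triangular

/-! ### Existence of the normal form -/

section NormalForm

/-- A commuting family on a complex space that fixes a nonzero functional `ℓ` has a basis in which
all its matrices lie in a block algebra and whose dual basis starts with `ℓ`. -/
lemma exists_composition_basis {V : Type*} [AddCommGroup V] [Module ℂ V] [FiniteDimensional ℂ V]
    {ι : Type*} (f : ι → End ℂ V) (hcomm : ∀ i j, Commute (f i) (f j)) {n : ℕ}
    (hV : finrank ℂ V = n + 1) (ℓ : V →ₗ[ℂ] ℂ) (hℓ : ℓ ≠ 0) (hf : ∀ i x, ℓ (f i x) = ℓ x) :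
    ∃ (c : Composition (n + 1)) (B : Basis (Fin (n + 1)) ℂ V),
      (∀ i, LinearMap.toMatrix B B (f i) ∈ blockAlgebra c) ∧
      ℓ (B 0) = 1 ∧ ∀ j : Fin n, ℓ (B j.succ) = 0 := by
  classical
  set W : (ι → ℂ) → Submodule ℂ V := fun χ => ⨅ i, (f i).maxGenEigenspace (χ i) with hWdef
  have htop : ⨆ χ, W χ = ⊤ :=
    End.iSup_iInf_maxGenEigenspace_eq_top_of_iSup_maxGenEigenspace_eq_top_of_commute f
      (fun i j _ => hcomm i j) fun i => End.iSup_maxGenEigenspace_eq_top (f i)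
  have hindep : iSupIndep W := End.independent_iInf_maxGenEigenspace_of_forall_mapsTo f
    fun i j φ => End.mapsTo_maxGenEigenspace_of_comm (hcomm j i) φ
  have hinv : ∀ χ i, ∀ x ∈ W χ, f i x ∈ W χ := by
    intro χ i x hx
    rw [hWdef, Submodule.mem_iInf] at hx ⊢
    exact fun j => End.mapsTo_maxGenEigenspace_of_comm (hcomm j i) (χ j) (hx j)
  have hnil : ∀ χ i, ∃ k, ∀ x ∈ W χ, ((f i - algebraMap ℂ (End ℂ V) (χ i)) ^ k) x = 0 := by
    intro χ i
    refine ⟨finrank ℂ V, fun x hx => ?_⟩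
    have h := (Submodule.mem_iInf _).1 hx i
    rw [End.maxGenEigenspace_eq_genEigenspace_finrank, End.mem_genEigenspace_nat] at h
    exact h
  -- On `W χ` some power of `f i - χ i` is zero, while `ℓ` turns it into multiplication by a power
  -- of `1 - χ i`.
  have hker : ∀ χ : ι → ℂ, χ ≠ 1 → ∀ x ∈ W χ, ℓ x = 0 := by
    intro χ hχ x hx
    obtain ⟨i, hi⟩ := Function.ne_iff.1 hχ
    obtain ⟨k, hk⟩ := hnil χ i
    have hpow : ∀ k, ℓ (((f i - algebraMap ℂ (End ℂ V) (χ i)) ^ k) x) = (1 - χ i) ^ k * ℓ x := by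
      intro k
      induction k with
      | zero => simp
      | succ k ih =>
        rw [pow_succ', End.mul_apply, LinearMap.sub_apply, map_sub, hf,
          Module.algebraMap_end_apply, map_smul, ih, smul_eq_mul]
        ring
    have h0 := hpow k
    rw [hk x hx, map_zero] at h0
    exact (mul_eq_zero.1 h0.symm).resolve_left (pow_ne_zero _ (sub_ne_zero.2 (Ne.symm hi)))
  obtain ⟨y, hyW, hy⟩ : ∃ y ∈ W 1, ℓ y = 1 := by
    by_contra! hno
    apply hℓ
    rw [← LinearMap.ker_eq_top, eq_top_iff, ← htop]
    refine iSup_le fun χ x hx => ?_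
    by_cases hχ : χ = 1
    · subst hχ
      by_contra hx0
      refine hno ((ℓ x)⁻¹ • x) (Submodule.smul_mem _ _ hx) ?_
      rw [map_smul, smul_eq_mul, inv_mul_cancel₀ hx0]
    · exact hker χ hχ x hx
  -- In the space of the trivial character, `y` is put before a lower basis of the hyperplane `ker
  -- ℓ`, which contains every `f i y - y`.
  obtain ⟨d₁, b₁, hb₁, hb₁ℓ⟩ : ∃ (d : ℕ) (b : Fin d → V), IsLowerBasis f 1 (W 1) b ∧
      ∀ j : Fin d, ℓ (b j) = if (j : ℕ) = 0 then 1 else 0 := by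
    obtain ⟨d, b, hb⟩ := exists_isLowerBasis (f := f) (χ := 1) hcomm (W 1 ⊓ LinearMap.ker ℓ)
      (fun i x hx => ⟨hinv 1 i x hx.1, (hf i x).trans hx.2⟩)
      (fun i => by
        obtain ⟨k, hk⟩ := hnil 1 i
        exact ⟨k, fun x hx => hk x hx.1⟩)
    refine ⟨d + 1, Fin.cons y b, hb.cons inf_le_left hyW ?_ ?_ ?_, ?_⟩
    · rintro ⟨-, h⟩
      rw [SetLike.mem_coe, LinearMap.mem_ker, hy] at h
      exact one_ne_zero h
    · intro x hx
      refine Submodule.mem_sup.2 ⟨x - ℓ x • y, ⟨Submodule.sub_mem _ hx (Submodule.smul_mem _ _ hyW),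
        ?_⟩, ℓ x • y, Submodule.smul_mem _ _ (Submodule.mem_span_singleton_self y), by simp⟩
      rw [SetLike.mem_coe, LinearMap.mem_ker, map_sub, map_smul, hy, smul_eq_mul, mul_one, sub_self]
    · intro i
      refine ⟨Submodule.sub_mem _ (hinv 1 i y hyW) (Submodule.smul_mem _ _ hyW), ?_⟩
      rw [SetLike.mem_coe, LinearMap.mem_ker, map_sub, map_smul, hf, hy]
      simp
    · intro j
      refine Fin.cases ?_ (fun j => ?_) j
      · simpa using hy
      · have : b j ∈ W 1 ⊓ LinearMap.ker ℓ := hb.2.1 ▸ Submodule.subset_span ⟨j, rfl⟩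
        simpa using this.2
  have hbasis : ∀ χ, ∃ (d : ℕ) (b : Fin d → V), IsLowerBasis f χ (W χ) b ∧
      ∀ j : Fin d, ℓ (b j) = if χ = 1 ∧ (j : ℕ) = 0 then 1 else 0 := by
    intro χ
    by_cases hχ : χ = 1
    · subst hχ
      exact ⟨d₁, b₁, hb₁, by simpa using hb₁ℓ⟩
    · obtain ⟨d, b, hb⟩ := exists_isLowerBasis (f := f) (χ := χ) hcomm (W χ) (hinv χ) (hnil χ)
      refine ⟨d, b, hb, fun j => ?_⟩
      rw [if_neg (fun h => hχ h.1)]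
      exact hker χ hχ _ (hb.2.1 ▸ Submodule.subset_span ⟨j, rfl⟩)
  have hW1 : W 1 ≠ ⊥ := by
    intro h
    rw [h, Submodule.mem_bot] at hyW
    rw [hyW, map_zero] at hy
    exact zero_ne_one hy
  have : Finite {χ // W χ ≠ ⊥} := WellFoundedGT.finite_ne_bot_of_iSupIndep hindep
  have := Fintype.ofFinite {χ // W χ ≠ ⊥}
  -- The trivial character is numbered first, so that `y` becomes `B 0` and `ℓ` vanishes on all
  -- other basis vectors.
  obtain ⟨e, he⟩ : ∃ e : Fin (Fintype.card {χ // W χ ≠ ⊥}) ≃ {χ // W χ ≠ ⊥},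
      ∀ k : Fin _, (k : ℕ) = 0 → e k = ⟨1, hW1⟩ := by
    have hpos : 0 < Fintype.card {χ // W χ ≠ ⊥} := Fintype.card_pos_iff.2 ⟨⟨1, hW1⟩⟩
    refine ⟨(Equiv.swap ⟨0, hpos⟩ ((Fintype.equivFin _) ⟨1, hW1⟩)).trans (Fintype.equivFin _).symm,
      fun k hk => ?_⟩
    obtain rfl : k = ⟨0, hpos⟩ := Fin.ext hk
    simp
  have hint : DirectSum.IsInternal W :=
    DirectSum.isInternal_submodule_of_iSupIndep_of_iSup_eq_top hindep htop
  have hintE : DirectSum.IsInternal fun k => W (e k) := by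
    have h := DirectSum.isInternal_ne_bot_iff.2 hint
    exact DirectSum.isInternal_submodule_of_iSupIndep_of_iSup_eq_top
      (h.submodule_iSupIndep.comp e.injective)
      ((e.surjective.iSup_comp fun χ : {χ // W χ ≠ ⊥} => W χ).trans h.submodule_iSup_eq_top)
  have hsum : ∑ k, finrank ℂ (W (e k)) = n + 1 := by
    rw [← hV]
    have := Module.finrank_eq_card_basis (hintE.collectedBasis fun k => Module.finBasis ℂ (W (e k)))
    rw [this, Fintype.card_sigma]
    simp
  obtain ⟨c, hc, hcd⟩ := exists_composition_blocksFun (fun k => finrank ℂ (W (e k)))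
    (fun k => Submodule.one_le_finrank_iff.2 (e k).2) hsum
  have hbasis' : ∀ k : Fin c.length, ∃ b : Fin (c.blocksFun k) → V,
      IsLowerBasis f (e (Fin.cast hc k)) (W (e (Fin.cast hc k))) b ∧
      ∀ j : Fin (c.blocksFun k), ℓ (b j) =
        if (e (Fin.cast hc k) : ι → ℂ) = 1 ∧ (j : ℕ) = 0 then 1 else 0 := by
    intro k
    obtain ⟨d, b, hb, hbℓ⟩ := hbasis (e (Fin.cast hc k))
    obtain rfl : d = c.blocksFun k := by rw [hb.card_eq, hcd]
    exact ⟨b, hb, hbℓ⟩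
  choose b hb hbℓ using hbasis'
  have hintC : DirectSum.IsInternal fun k : Fin c.length => W (e (Fin.cast hc k)) :=
    DirectSum.isInternal_submodule_of_iSupIndep_of_iSup_eq_top
      (hintE.submodule_iSupIndep.comp (finCongr hc).injective)
      (((finCongr hc).surjective.iSup_comp fun k => W (e k)).trans hintE.submodule_iSup_eq_top)
  obtain ⟨B, hB, hBf⟩ := exists_basis_toMatrix_mem_blockAlgebra (f := f) c _ hintC _ b hb
  have hone : ∀ k : Fin c.length, (e (Fin.cast hc k) : ι → ℂ) = 1 ↔ (k : ℕ) = 0 := by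
    intro k
    have hk0 : 0 < c.length := k.pos
    constructor
    · intro h
      have h1 : e (Fin.cast hc k) = e (Fin.cast hc ⟨0, hk0⟩) := by
        rw [he (Fin.cast hc ⟨0, hk0⟩) rfl]
        exact Subtype.ext h
      have h2 := e.injective h1
      simpa [Fin.ext_iff] using h2
    · intro h
      rw [he (Fin.cast hc k) h]
  have hℓB : ∀ j, ℓ (B j) = if (j : ℕ) = 0 then 1 else 0 := by
    intro j
    rw [hB, hbℓ, hone]
    congr 1
    rw [eq_iff_iff]
    constructor
    · rintro ⟨h1, h2⟩
      rw [Composition.coe_invEmbedding, h1, Composition.sizeUpTo_zero] at h2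
      exact h2
    · intro h
      obtain rfl : j = 0 := Fin.ext h
      have h3 : (c.index 0 : ℕ) = 0 := by
        by_contra hne
        have h4 := c.sizeUpTo_index_le 0
        have h5 := c.sizeUpTo_strict_mono (i := 0) (by have := (c.index 0).pos; exact this)
        have h6 : c.sizeUpTo (0 + 1) ≤ c.sizeUpTo (c.index 0) := c.monotone_sizeUpTo (by omega)
        rw [Fin.val_zero] at h4
        omega
      exact ⟨h3, by simp⟩
  refine ⟨c, B, hBf, by simpa using hℓB 0, fun j => by simpa using hℓB j.succ⟩

variable {n : ℕ}

lemma exists_affineEquiv_Phi_eq {P : Matrix (Fin (n + 1)) (Fin (n + 1)) ℂ} (hP : IsUnit P)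
    (h0 : P 0 0 = 1) (h : ∀ j : Fin n, P 0 j.succ = 0) : ∃ φ : GA n, Phi (φ : MA n) = P := by
  obtain ⟨β, hβ⟩ := exists_blockMatrix_eq 1 P h0 h
  replace hβ : Phi β = P := hβ
  have hdet := (Matrix.isUnit_iff_isUnit_det _).1 hP
  have hs : Function.Surjective β := surjective_of_isUnit_Phi (hβ ▸ hP)
  have hi : Function.Injective β := by
    intro x y hxy
    have h1 : P.mulVec (Fin.cons 1 x) = P.mulVec (Fin.cons 1 y) := by
      rw [← hβ, Phi_mulVec, Phi_mulVec, hxy]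
    exact (Fin.cons_inj.1 (Matrix.mulVec_injective_of_isUnit hP h1)).2
  exact ⟨AffineEquiv.ofBijective ⟨hi, hs⟩, hβ⟩

/-- The fixed functional is the first coordinate; its values on the new basis are the first row of
the change of basis matrix, which is therefore `(1, 0, …, 0)` as `Φ(GA)` requires. -/
theorem exists_isNormalForm (𝒢 : Subsemigroup (MA n)) (hab : ∀ f ∈ 𝒢, ∀ g ∈ 𝒢, f * g = g * f) :
    ∃ (η : Composition (n + 1)) (φ : GA n), IsNormalForm 𝒢 η φ := by
  obtain ⟨c, B, hB, hB0, hBs⟩ := exists_composition_basis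
    (fun f : 𝒢 => Matrix.toLin' (Phi (f : MA n)))
    (fun f g => by
      change _ * _ = _ * _
      rw [Module.End.mul_eq_comp, Module.End.mul_eq_comp, ← Matrix.toLin'_mul, ← Matrix.toLin'_mul,
        (commute_Phi hab f.2 g.2).eq])
    (n := n) (by simp) (LinearMap.proj 0 : (Fin (n + 1) → ℂ) →ₗ[ℂ] ℂ)
    (fun h => by
      have := LinearMap.congr_fun h (fun _ => (1 : ℂ))
      simp at this)
    (fun f x => by
      have := mulVec_cons_zero (Phi_zero_succ (f : MA n)) (x 0) (Fin.tail x)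
      rw [Fin.cons_self_tail] at this
      simpa using this)
  set s := Pi.basisFun ℂ (Fin (n + 1)) with hs
  have hPB : B.toMatrix s * s.toMatrix B = 1 := Basis.toMatrix_mul_toMatrix_flip _ _
  obtain ⟨φ, hφ⟩ := exists_affineEquiv_Phi_eq (P := s.toMatrix B) (IsUnit.of_mul_eq_one_right _ hPB)
    hB0 hBs
  refine ⟨c, φ, fun f hf => ?_⟩
  rw [hφ, Matrix.inv_eq_left_inv hPB]
  have h := basis_toMatrix_mul_linearMap_toMatrix_mul_basis_toMatrix B s B s
    (Matrix.toLin' (Phi f))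
  have h2 : LinearMap.toMatrix s s (Matrix.toLin' (Phi f)) = Phi f := by
    rw [hs]
    exact LinearMap.toMatrix'_toLin' _
  rw [h2] at h
  rw [h]
  exact hB ⟨f, hf⟩

end NormalForm
end AffineSemigroup

theorem theorem1p1 (n : ℕ) (hn : 1 ≤ n) (𝒢 : Subsemigroup (AffineSemigroup.MA n))
    (hab : ∀ f ∈ 𝒢, ∀ g ∈ 𝒢, f * g = g * f) :
    (∃ (η : Composition (n + 1)) (φ : AffineSemigroup.GA n),
      AffineSemigroup.IsNormalForm 𝒢 η φ) ∧
    ∀ (η : Composition (n + 1)) (φ : AffineSemigroup.GA n),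
      AffineSemigroup.IsNormalForm 𝒢 η φ →
      List.TFAE [
        AffineSemigroup.IsHypercyclic 𝒢,
        Dense (AffineSemigroup.orbit (𝒢 : Set (AffineSemigroup.MA n))
          (AffineSemigroup.w₀ η φ)),
        (∃ Q : AddSubsemigroup (Fin n → ℂ),
          (Q : Set (Fin n → ℂ)) =
            AffineSemigroup.orbit (AffineSemigroup.affineLogs 𝒢 η φ) (AffineSemigroup.w₀ η φ)) ∧
          Dense (AffineSemigroup.orbit (AffineSemigroup.affineLogs 𝒢 η φ)
            (AffineSemigroup.w₀ η φ))] :=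
  ⟨AffineSemigroup.exists_isNormalForm 𝒢 hab,
    fun _ _ hnf => AffineSemigroup.tfae_of_isNormalForm hab hnf⟩
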